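/- Let $\mathcal M=\{1,\dots,M\}$ with $M\ge 1$, let $\gamma>0$, and for $m\in\mathcal M$ let $A^m,D^m\in\mathbb R^{n\times n}$ and $\sigma^m\in\mathbb R^{n\times k}$. Consider the value function $$V(x)=\sup_{w}\sup_{\mu}\sup_{T>0}\int_0^T \tfrac12\,\xi_t'D^{\mu_t}\xi_t-\tfrac{\gamma^2}{2}|w_t|^2\,dt,\qquad \dot\xi=A^{\mu_t}\xi+\sigma^{\mu_t}w_t,\quad \xi_0=x\in\mathbb R^n,$$ where $\mu:[0,\infty)\to\mathcal M$ is measurable and $w:[0,\infty)\to\mathbb R^k$ is locally square integrable. For $m\in\mathcal M$ and $\tau>0$ let $$S^m_\tau[V^0](x)=\sup_w\Big\{\int_0^\tau \tfrac12\,\xi_t'D^{m}\xi_t-\tfrac{\gamma^2}{2}|w_t|^2\,dt+V^0(\xi_\tau)\Big\},\qquad \dot\xi=A^m\xi+\sigma^mw,\quad \xi_0=x,$$ and $\tilde S_\tau=\sup_{m\in\mathcal M}S^m_\tau$. The max-plus method with time step $\tau$ and $N$ iterations, started from $V^0(x)=\frac12x'P_0x$, approximates $V$ by $$\{\tilde S_\tau\}^N[V^0]=\sup_{i_1,\dots,i_N\in\mathcal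 M}S_\tau^{i_N}\cdots S_\tau^{i_1}[V^0].$$ Assume that there are constants $c_A,c_\sigma,m_D>0$ and $c_D$ such that, for all $m\in\mathcal M$ and all $x$: * (Assumption 1) $x'A^mx\le -c_A|x|^2$; $|\sigma^m|\le c_\sigma$ (operator norm); $D^m$ is symmetric positive definite with $x'D^mx\le c_D|x|^2$; and $c_A^2>c_Dc_\sigma^2/\gamma^2$; * (Assumption 2) $x'D^mx\ge m_D|x|^2$ and $\frac{c_\sigma^2}{\gamma^2}m_D>\big(c_A-\sqrt{c_A^2-c_Dc_\sigma^2/\gamma^2}\big)^2$. Fix $\lambda<\lambda_2:=\sqrt{m_D\gamma^2/c_\sigma^2}$ and $e>0$. A function $f$ is said to approximate $g$ to accuracy $\varepsilon$ if both are finite and $|f(x)-g(x)|\le\varepsilon|x|^2$ for all $x\in\mathbb R^n$. Then there is a constant $C>0$, depending on the problem data, $\lambda$ and $e$, such that for all sufficiently small $\varepsilon>0$ there are a time step $\tau>0$ and a number of iterations $$N\le C\,\frac{-\log\varepsilon}{\varepsilon}$$ for which the following holds for every initial matrix $P_0$ with $eI\le P_0\le\lambda I$. 1. *Iterations.* $\{\tilde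 S_\tau\}^N[V^0]$ approximates $V$ to accuracy $\varepsilon$. 2. *Arithmetic cost.* The $M^N$ quadratic functions of the method can be computed, to accuracy $\varepsilon$, by additions, subtractions and multiplications of real numbers: there is a straight-line program, depending only on $n,M,N$, whose inputs are $\tau$ and the entries of $P_0$ and of $A^m,D^m,\Sigma^m=\gamma^{-2}\sigma^m(\sigma^m)'$ ($m\in\mathcal M$), together with rational constants, and whose outputs are matrices $Q_{i_1\cdots i_N}$, such that $\frac12x'Q_{i_1\cdots i_N}x$ approximates $S_\tau^{i_N}\cdots S_\tau^{i_1}[V^0]$ to accuracy $\varepsilon$ for each word $i_1\cdots i_N\in\mathcal M^N$, and $\sup_{i_1,\dots,i_N}\frac12x'Q_{i_1\cdots i_N}x$ approximates $V$ to accuracy $\varepsilon$. If $M\ge2$, the number of operations of this program is at most $$c\,|\mathcal M|^{\,C(-\log\varepsilon)/\varepsilon}\,n^3,$$ where $c$ is an absolute constant. -/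

import Mathlib

open scoped Matrix Topology
open MeasureTheory

/-! ### The switching linear quadratic control problem

Vectors of `ℝⁿ` are functions `Fin n → ℝ`; the Euclidean square norm `|x|²` is always written
`x ⬝ᵥ x`, so that the sup norm carried by this type plays no role. Value functions take values in
the extended reals: no supremum is ever replaced by a default value. -/

/-- The data of a switching linear quadratic optimal control problem with state space `ℝⁿ`,
disturbances in `ℝᵏ` and switching index set `{1, …, M}`. -/
structure SwitchingLQ (n k M : ℕ) where
  A : Fin M → Matrix (Fin n) (Fin n) ℝ
  sig : Fin M → Matrix (Fin n) (Fin k) ℝ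
  D : Fin M → Matrix (Fin n) (Fin n) ℝ
  γ : ℝ

namespace SwitchingLQ

variable {n k M : ℕ}

/-- The first assumption on the data, with constants `cA`, `cσ`, `cD`. The bound `|σᵐ| ≤ cσ` is
the one on the operator norm. -/
structure Assumption1 (p : SwitchingLQ n k M) (cA cσ cD : ℝ) : Prop where
  γ_pos : 0 < p.γ
  cA_pos : 0 < cA
  cσ_pos : 0 < cσ
  stable : ∀ (m : Fin M) (x : Fin n → ℝ), x ⬝ᵥ (p.A m *ᵥ x) ≤ -cA * (x ⬝ᵥ x)
  sig_le : ∀ (m : Fin M) (w : Fin k → ℝ),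
    (p.sig m *ᵥ w) ⬝ᵥ (p.sig m *ᵥ w) ≤ cσ ^ 2 * (w ⬝ᵥ w)
  D_posDef : ∀ m : Fin M, (p.D m).PosDef
  D_le : ∀ (m : Fin M) (x : Fin n → ℝ), x ⬝ᵥ (p.D m *ᵥ x) ≤ cD * (x ⬝ᵥ x)
  gap : cD * cσ ^ 2 / p.γ ^ 2 < cA ^ 2

/-- The second assumption on the data, with the further constant `mD`. -/
structure Assumption2 (p : SwitchingLQ n k M) (cA cσ cD mD : ℝ) : Prop where
  mD_pos : 0 < mD
  le_D : ∀ (m : Fin M) (x : Fin n → ℝ), mD * (x ⬝ᵥ x) ≤ x ⬝ᵥ (p.D m *ᵥ x)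
  gap : (cA - √(cA ^ 2 - cD * cσ ^ 2 / p.γ ^ 2)) ^ 2 < cσ ^ 2 / p.γ ^ 2 * mD

/-- The admissible disturbances: `w : [0, ∞) → ℝᵏ` measurable with `∫₀ᵀ |w|² < ∞` for all `T`
(the values at negative times are irrelevant). -/
def IsDisturbance (w : ℝ → Fin k → ℝ) : Prop :=
  ∀ T : ℝ, AEStronglyMeasurable w (volume.restrict (Set.Icc 0 T)) ∧
    IntegrableOn (fun t => w t ⬝ᵥ w t) (Set.Icc 0 T)

/-- `ξ` solves `ξ' = A^{μ} ξ + σ^{μ} w`, `ξ₀ = x` on `[0, T]` in the sense of Carathéodory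
(integrated form of the equation). -/
def IsTrajectory (p : SwitchingLQ n k M) (x : Fin n → ℝ) (T : ℝ) (w : ℝ → Fin k → ℝ)
    (μ : ℝ → Fin M) (ξ : ℝ → Fin n → ℝ) : Prop :=
  ContinuousOn ξ (Set.Icc 0 T) ∧
    ∀ t ∈ Set.Icc 0 T,
      ξ t = x + ∫ s in (0 : ℝ)..t, (p.A (μ s) *ᵥ ξ s + p.sig (μ s) *ᵥ w s)

/-- The running payoff `∫₀ᵀ ½ ξ' D^{μ} ξ - (γ²/2) |w|² dt`. -/
noncomputable def running (p : SwitchingLQ n k M) (T : ℝ) (w : ℝ → Fin k → ℝ)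
    (μ : ℝ → Fin M) (ξ : ℝ → Fin n → ℝ) : ℝ :=
  ∫ t in (0 : ℝ)..T,
    ((1 / 2) * (ξ t ⬝ᵥ (p.D (μ t) *ᵥ ξ t)) - p.γ ^ 2 / 2 * (w t ⬝ᵥ w t))

/-- The value function `V` of the infinite horizon problem. -/
noncomputable def value (p : SwitchingLQ n k M) (x : Fin n → ℝ) : EReal :=
  ⨆ (w : ℝ → Fin k → ℝ) (_ : IsDisturbance w) (μ : ℝ → Fin M) (_ : Measurable μ)
    (T : ℝ) (_ : 0 < T) (ξ : ℝ → Fin n → ℝ) (_ : p.IsTrajectory x T w μ ξ),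
    ((p.running T w μ ξ : ℝ) : EReal)

/-- The semigroup `Sᵐ_T` of the problem in which the index is frozen to `m`. -/
noncomputable def semigroupAt (p : SwitchingLQ n k M) (m : Fin M) (T : ℝ)
    (V₀ : (Fin n → ℝ) → EReal) (x : Fin n → ℝ) : EReal :=
  ⨆ (w : ℝ → Fin k → ℝ) (_ : IsDisturbance w) (ξ : ℝ → Fin n → ℝ)
    (_ : p.IsTrajectory x T w (fun _ => m) ξ),
    ((p.running T w (fun _ => m) ξ : ℝ) : EReal) + V₀ (ξ T)

/-- One iteration of the max-plus method: `S̃_τ = sup_m Sᵐ_τ`. -/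
noncomputable def maxPlusStep (p : SwitchingLQ n k M) (τ : ℝ)
    (V₀ : (Fin n → ℝ) → EReal) (x : Fin n → ℝ) : EReal :=
  ⨆ m : Fin M, p.semigroupAt m τ V₀ x

/-- `N` iterations of the max-plus method started from `V₀`: the function `{S̃_τ}ᴺ[V₀]`. -/
noncomputable def maxPlusIterate (p : SwitchingLQ n k M) (τ : ℝ) (N : ℕ)
    (V₀ : (Fin n → ℝ) → EReal) : (Fin n → ℝ) → EReal :=
  (p.maxPlusStep τ)^[N] V₀

/-- The function `S_τ^{i_N} ⋯ S_τ^{i_1}[V₀]` propagated along the word `(i_1, …, i_N)`. -/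
noncomputable def propagate (p : SwitchingLQ n k M) (τ : ℝ) {N : ℕ} (i : Fin N → Fin M)
    (V₀ : (Fin n → ℝ) → EReal) : (Fin n → ℝ) → EReal :=
  (List.ofFn i).foldl (fun f m => p.semigroupAt m τ f) V₀

end SwitchingLQ

/-- The quadratic function `x ↦ ½ x' P x`. -/
noncomputable def quadFun {n : ℕ} (P : Matrix (Fin n) (Fin n) ℝ) (x : Fin n → ℝ) : EReal :=
  (((1 / 2) * (x ⬝ᵥ (P *ᵥ x)) : ℝ) : EReal)

/-- `f` and `g` are finite everywhere and `|f(x) - g(x)| ≤ ε |x|²` for all `x`. -/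
def ApproxWithin {n : ℕ} (ε : ℝ) (f g : (Fin n → ℝ) → EReal) : Prop :=
  ∀ x, ∃ a b : ℝ, f x = (a : EReal) ∧ g x = (b : EReal) ∧ |a - b| ≤ ε * (x ⬝ᵥ x)

/-- The order interval `[a I, b I]` of symmetric matrices for the Loewner order. -/
def loewnerInterval (n : ℕ) (a b : ℝ) : Set (Matrix (Fin n) (Fin n) ℝ) :=
  {P | (P - a • (1 : Matrix (Fin n) (Fin n) ℝ)).PosSemidef ∧
    (b • (1 : Matrix (Fin n) (Fin n) ℝ) - P).PosSemidef}

/-! ### Arithmetic operations -/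

/-- The numerical input of the method: the coefficients `Aᵐ, Dᵐ, Σᵐ` of the quadratic
Hamiltonians, the time step `τ` and the matrix `P` of the initial quadratic function. -/
structure MethodInput (n M : ℕ) where
  A : Fin M → Matrix (Fin n) (Fin n) ℝ
  D : Fin M → Matrix (Fin n) (Fin n) ℝ
  S : Fin M → Matrix (Fin n) (Fin n) ℝ
  τ : ℝ
  P : Matrix (Fin n) (Fin n) ℝ

/-- The input attached to a problem. Here `Σᵐ = γ⁻² σᵐ (σᵐ)'` is the matrix for which
`sup_w (p' σᵐ w - (γ²/2) |w|²) = ½ p' Σᵐ p`. -/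
noncomputable def SwitchingLQ.input {n k M : ℕ} (p : SwitchingLQ n k M) (τ : ℝ)
    (P : Matrix (Fin n) (Fin n) ℝ) : MethodInput n M where
  A := p.A
  D := p.D
  S := fun m => (1 / p.γ ^ 2) • (p.sig m * (p.sig m)ᵀ)
  τ := τ
  P := P

/-- What is available before any operation: the entries of the input and rational constants,
all seen as functions of the input. -/
def initialValues (n M : ℕ) : Set (MethodInput n M → ℝ) :=
  {f | (∃ q : ℚ, f = fun _ => (q : ℝ)) ∨ (∃ m i j, f = fun X => X.A m i j) ∨
    (∃ m i j, f = fun X => X.D m i j) ∨ (∃ m i j, f = fun X => X.S m i j) ∨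
    (f = fun X => X.τ) ∨ (∃ i j, f = fun X => X.P i j)}

/-- `StraightLine I t G`: some straight-line program which starts from the values in `I` and
performs `t` arithmetic operations (additions, subtractions, multiplications), each of them on
values which are already available, has `G` as its set of available values at the end. Values are
functions of the input `X`, so that one program serves all inputs. -/
inductive StraightLine {X : Type} (I : Set (X → ℝ)) : ℕ → Set (X → ℝ) → Prop
  | start : StraightLine I 0 I
  | add {t : ℕ} {G : Set (X → ℝ)} {f g : X → ℝ} :
      StraightLine I t G → f ∈ G → g ∈ G → StraightLine I (t + 1) (insert (fun x => f x + g x) G)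
  | sub {t : ℕ} {G : Set (X → ℝ)} {f g : X → ℝ} :
      StraightLine I t G → f ∈ G → g ∈ G → StraightLine I (t + 1) (insert (fun x => f x - g x) G)
  | mul {t : ℕ} {G : Set (X → ℝ)} {f g : X → ℝ} :
      StraightLine I t G → f ∈ G → g ∈ G → StraightLine I (t + 1) (insert (fun x => f x * g x) G)

/-- The matrices `Q i`, one for each word `i ∈ {1, …, M}ᴺ`, are obtained from the input by a
straight-line program with `t` arithmetic operations. -/
def ComputedWith {n M N : ℕ}
    (Q : (Fin N → Fin M) → MethodInput n M → Matrix (Fin n) (Fin n) ℝ) (t : ℕ) : Prop :=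
  ∃ G, StraightLine (initialValues n M) t G ∧ ∀ i a b, (fun X => Q i X a b) ∈ G

/-! Everything is compared with the explicit Euler scheme `R ↦ R + τ ric_m(R)`, `ric_m(R) = A'R + RA
+ RΣR + D`, whose matrices along words are also the output of the program. On quadratic functions,
one step of the true semigroup differs from an Euler step by `O(τ²)` (`CoreBounds.exists_one_step`).

The point is that these errors do not accumulate. One has `ric_m(rR) = r ric_m(R) + (1 - r)(D -
rRΣR)`, and `D - RΣR` is uniformly positive for `0 ≤ R ≤ lam I` once `lam < λ₂`. So a factor `1 +
cτ` in front of `R` gains a slack of order `cτ²` per step, which beats the local error when `c` is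
large. Hence `1 + cτ` times the Euler scheme dominates the semigroups, and `1 - cτ` times it is
dominated by them, with the same factor at every step (`CoreBounds.exists_euler_bounds`). The total
error is `O(τ)`, and `τ` proportional to `ε` suffices.

For the horizon, put `β = cσ²/γ²`. The assumptions leave room for a `lam` strictly between the roots
of `βλ² - 2cAλ + cD` and below `√(mD/β)`. Then `lam I` is a strict supersolution: the terminal
payoff `g = ½ lam |x|²` loses a factor `1 - κτ` per step. Mixing `g` with `V` or with the Euler
maxima shows that the initial matrix is forgotten up to a multiple of `(1 - κτ)^N`
(`CoreBounds.exists_estimates`), so `N` of order `log(1/ε)/τ` is enough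
(`CoreBounds.exists_accuracy`).

The basic upper bounds come from verification: completing the square in the energy balance shows
that a time dependent matrix supersolution bounds the payoff for every measurable switching signal.
The lower bounds in the one-step expansion use an explicit linear feedback. No Riccati equation is
ever solved and no optimal control is needed.

For the cost, an Euler step takes four matrix products and `O(n²)` further operations, and words
share their prefixes, so the total is a geometric sum of order `M^N n³`. -/

/-! ### Absolutely continuous functions with a given derivative -/

/-- `f` is absolutely continuous on `[0, T]` with almost everywhere derivative `f'`. -/
def HasACDeriv (T : ℝ) (f f' : ℝ → ℝ) : Prop :=
  AbsolutelyContinuousOnInterval f 0 T ∧ ∀ᵐ t, t ∈ Set.uIcc 0 T → HasDerivAt f (f' t) t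

namespace HasACDeriv

variable {T : ℝ} {f f' g g' : ℝ → ℝ}

theorem ae_eq_deriv (hf : HasACDeriv T f f') :
    deriv f =ᵐ[volume.restrict (Set.uIoc 0 T)] f' := by
  rw [Filter.EventuallyEq, ae_restrict_iff' measurableSet_uIoc]
  filter_upwards [hf.2] with t ht htm
  exact (ht (Set.uIoc_subset_uIcc htm)).deriv

theorem intervalIntegrable (hf : HasACDeriv T f f') : IntervalIntegrable f' volume 0 T :=
  hf.1.intervalIntegrable_deriv.congr_ae hf.ae_eq_deriv

theorem integral_eq_sub (hf : HasACDeriv T f f') : ∫ t in (0 : ℝ)..T, f' t = f T - f 0 := by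
  rw [← hf.1.integral_deriv_eq_sub]
  exact intervalIntegral.integral_congr_ae_restrict hf.ae_eq_deriv.symm

theorem congr_deriv (hf : HasACDeriv T f f') (h : ∀ t, f' t = g' t) : HasACDeriv T f g' := by
  have : f' = g' := funext h
  exact this ▸ hf

theorem mul (hf : HasACDeriv T f f') (hg : HasACDeriv T g g') :
    HasACDeriv T (fun t => f t * g t) (fun t => f' t * g t + f t * g' t) := by
  refine ⟨hf.1.mul hg.1, ?_⟩
  filter_upwards [hf.2, hg.2] with t h1 h2 ht
  exact (h1 ht).mul (h2 ht)

theorem add (hf : HasACDeriv T f f') (hg : HasACDeriv T g g') :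
    HasACDeriv T (fun t => f t + g t) (fun t => f' t + g' t) := by
  refine ⟨hf.1.add hg.1, ?_⟩
  filter_upwards [hf.2, hg.2] with t h1 h2 ht
  exact (h1 ht).add (h2 ht)

theorem const_mul (c : ℝ) (hf : HasACDeriv T f f') :
    HasACDeriv T (fun t => c * f t) (fun t => c * f' t) := by
  refine ⟨hf.1.const_mul c, ?_⟩
  filter_upwards [hf.2] with t h1 ht
  exact (h1 ht).const_mul c

theorem of_hasDerivAt (hf : ∀ t, HasDerivAt f (f' t) t) (hc : Continuous f') :
    HasACDeriv T f f' := by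
  refine ⟨ContDiffOn.absolutelyContinuousOnInterval ?_, .of_forall fun t _ => hf t⟩
  refine (contDiff_one_iff_deriv.2 ⟨fun t => (hf t).differentiableAt, ?_⟩).contDiffOn
  rwa [show deriv f = f' from funext fun t => (hf t).deriv]

theorem const (c : ℝ) : HasACDeriv T (fun _ => c) (fun _ => 0) :=
  of_hasDerivAt (fun t => hasDerivAt_const t c) continuous_const

theorem sum {ι : Type*} (s : Finset ι) {f f' : ι → ℝ → ℝ}
    (hf : ∀ i ∈ s, HasACDeriv T (f i) (f' i)) :
    HasACDeriv T (fun t => ∑ i ∈ s, f i t) (fun t => ∑ i ∈ s, f' i t) := by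
  classical
  induction s using Finset.induction_on with
  | empty => simpa using const 0
  | insert a s ha ih =>
    simp only [Finset.sum_insert ha]
    exact (hf a (by simp)).add (ih fun i hi => hf i (by simp [hi]))

theorem of_integral (x : ℝ) (hf : IntervalIntegrable f' volume 0 T) :
    HasACDeriv T (fun t => x + ∫ s in (0 : ℝ)..t, f' s) f' := by
  refine ⟨((const x).1.add (hf.absolutelyContinuousOnInterval_intervalIntegral
    (c := 0) Set.left_mem_uIcc) :),
    ?_⟩
  filter_upwards [hf.ae_hasDerivAt_integral] with t ht htm
  exact (ht htm 0 (by simp)).const_add x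

end HasACDeriv

/-- The derivative of `½ ξ' P ξ`. -/
theorem HasACDeriv.quadratic {n : ℕ} {T : ℝ} {ξ ξ' : ℝ → Fin n → ℝ}
    {P P' : ℝ → Matrix (Fin n) (Fin n) ℝ}
    (hξ : ∀ i, HasACDeriv T (fun t => ξ t i) (fun t => ξ' t i))
    (hP : ∀ i j, HasACDeriv T (fun t => P t i j) (fun t => P' t i j)) :
    HasACDeriv T (fun t => ξ t ⬝ᵥ (P t *ᵥ ξ t))
      (fun t => ξ' t ⬝ᵥ (P t *ᵥ ξ t) + ξ t ⬝ᵥ (P' t *ᵥ ξ t) + ξ t ⬝ᵥ (P t *ᵥ ξ' t)) := by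
  simp only [dotProduct, Matrix.mulVec]
  refine (HasACDeriv.sum Finset.univ fun i _ => (hξ i).mul
    (HasACDeriv.sum Finset.univ fun j _ => (hP i j).mul (hξ j))).congr_deriv fun t => ?_
  simp only [Finset.sum_add_distrib, mul_add]
  ring

/-! ### Integrability along trajectories and the energy balance -/

namespace SwitchingLQ

variable {n k M : ℕ}

theorem intervalIntegrable_comp_index {μ : ℝ → Fin M} (hμ : Measurable μ) (F : Fin M → ℝ)
    (a b : ℝ) : IntervalIntegrable (fun t => F (μ t)) volume a b := by
  have hm : Measurable fun t => F (μ t) := (measurable_of_finite F).comp hμ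
  refine (intervalIntegrable_const (c := ∑ m, |F m|)).mono_fun hm.aestronglyMeasurable
    (.of_forall fun t => ?_)
  simp only [Real.norm_eq_abs]
  rw [abs_of_nonneg (Finset.sum_nonneg fun m _ => abs_nonneg (F m))]
  exact Finset.single_le_sum (f := fun m => |F m|) (fun m _ => abs_nonneg _) (Finset.mem_univ _)

theorem IsDisturbance.intervalIntegrable_sq {w : ℝ → Fin k → ℝ} (hw : IsDisturbance w) {T : ℝ}
    (hT : 0 ≤ T) : IntervalIntegrable (fun t => w t ⬝ᵥ w t) volume 0 T :=
  (intervalIntegrable_iff_integrableOn_Icc_of_le hT).2 (hw T).2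

/-- Square integrable functions on a bounded interval are integrable, here through `|w_l| ≤ 1 +
|w|²`. -/
theorem IsDisturbance.intervalIntegrable {w : ℝ → Fin k → ℝ} (hw : IsDisturbance w) {T : ℝ}
    (hT : 0 ≤ T) (l : Fin k) : IntervalIntegrable (fun t => w t l) volume 0 T := by
  rw [intervalIntegrable_iff_integrableOn_Icc_of_le hT]
  have h1 : IntegrableOn (fun t => 1 + w t ⬝ᵥ w t) (Set.Icc 0 T) :=
    (integrableOn_const (by simp)).add (hw T).2
  refine h1.mono' ?_ (.of_forall fun t => ?_)
  · exact (continuous_apply l).comp_aestronglyMeasurable (hw T).1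
  · have h2 : w t l * w t l ≤ w t ⬝ᵥ w t :=
      Finset.single_le_sum (f := fun i => w t i * w t i) (fun i _ => mul_self_nonneg _)
        (Finset.mem_univ l)
    rw [Real.norm_eq_abs]
    nlinarith [sq_abs (w t l), sq_nonneg (|w t l| - 1)]

/-- Each coordinate of the velocity field along a trajectory is integrable. -/
theorem intervalIntegrable_drift (p : SwitchingLQ n k M) {T : ℝ} (hT : 0 ≤ T)
    {w : ℝ → Fin k → ℝ} (hw : IsDisturbance w) {μ : ℝ → Fin M} (hμ : Measurable μ)
    {ξ : ℝ → Fin n → ℝ} (hξ : ContinuousOn ξ (Set.Icc 0 T)) (i : Fin n) :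
    IntervalIntegrable (fun s => (p.A (μ s) *ᵥ ξ s + p.sig (μ s) *ᵥ w s) i) volume 0 T := by
  have hξ' : ∀ j, ContinuousOn (fun t => ξ t j) (Set.uIcc 0 T) := by
    intro j
    rw [Set.uIcc_of_le hT]
    exact (continuous_apply j).comp_continuousOn hξ
  have h1 : ∀ l, IntervalIntegrable (fun s => p.sig (μ s) i l * w s l) volume 0 T := by
    intro l
    have hm : Measurable fun s => p.sig (μ s) i l :=
      (measurable_of_finite fun m => p.sig m i l).comp hμ
    have := hw.intervalIntegrable hT l
    rw [intervalIntegrable_iff] at this ⊢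
    refine Integrable.bdd_mul (c := ∑ m, |p.sig m i l|) this hm.aestronglyMeasurable
      (.of_forall fun t => ?_)
    exact Finset.single_le_sum (f := fun m => |p.sig m i l|) (fun m _ => abs_nonneg _)
      (Finset.mem_univ _)
  have h2 : ∀ j, IntervalIntegrable (fun s => p.A (μ s) i j * ξ s j) volume 0 T := fun j =>
    (intervalIntegrable_comp_index hμ (fun m => p.A m i j) 0 T).mul_continuousOn (hξ' j)
  simp only [Pi.add_apply, Matrix.mulVec, dotProduct]
  refine IntervalIntegrable.add ?_ ?_
  · exact (IntervalIntegrable.sum Finset.univ fun j _ => h2 j).congr fun t _ => by simp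
  · exact (IntervalIntegrable.sum Finset.univ fun l _ => h1 l).congr fun t _ => by simp

theorem intervalIntegrable_payoff (p : SwitchingLQ n k M) {T : ℝ} (hT : 0 ≤ T)
    {w : ℝ → Fin k → ℝ} (hw : IsDisturbance w) {μ : ℝ → Fin M} (hμ : Measurable μ)
    {ξ : ℝ → Fin n → ℝ} (hξ : ContinuousOn ξ (Set.Icc 0 T)) :
    IntervalIntegrable (fun t => (1 / 2) * (ξ t ⬝ᵥ (p.D (μ t) *ᵥ ξ t)) -
      p.γ ^ 2 / 2 * (w t ⬝ᵥ w t)) volume 0 T := by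
  have hξ' : ∀ j, ContinuousOn (fun t => ξ t j) (Set.uIcc 0 T) := by
    intro j
    rw [Set.uIcc_of_le hT]
    exact (continuous_apply j).comp_continuousOn hξ
  refine IntervalIntegrable.sub (.const_mul ?_ _) ((hw.intervalIntegrable_sq hT).const_mul _)
  have h2 : ∀ i j, IntervalIntegrable (fun s => ξ s i * (p.D (μ s) i j * ξ s j)) volume 0 T :=
    fun i j => ((intervalIntegrable_comp_index hμ (fun m => p.D m i j) 0 T).mul_continuousOn
      (hξ' j)).continuousOn_mul (hξ' i)
  simp only [Matrix.mulVec, dotProduct, Finset.mul_sum]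
  have := IntervalIntegrable.sum (μ := volume) (a := 0) (b := T) Finset.univ
    fun i _ => IntervalIntegrable.sum Finset.univ fun j _ => h2 i j
  refine this.congr fun t _ => ?_
  simp

/-- The vector integral can be evaluated coordinatewise only if every coordinate is integrable (a
non-integrable function has integral `0` by convention); `intervalIntegrable_drift` supplies this.
-/
theorem IsTrajectory.apply_eq {p : SwitchingLQ n k M} {x : Fin n → ℝ} {T : ℝ}
    {w : ℝ → Fin k → ℝ} (hw : IsDisturbance w) {μ : ℝ → Fin M} (hμ : Measurable μ)
    {ξ : ℝ → Fin n → ℝ} (h : p.IsTrajectory x T w μ ξ) {t : ℝ} (ht : t ∈ Set.Icc 0 T)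
    (i : Fin n) :
    ξ t i = x i + ∫ s in (0 : ℝ)..t, (p.A (μ s) *ᵥ ξ s + p.sig (μ s) *ᵥ w s) i := by
  rw [h.2 t ht, Pi.add_apply, intervalIntegral.integral_of_le ht.1,
    intervalIntegral.integral_of_le ht.1, eval_integral]
  intro j
  have := p.intervalIntegrable_drift ht.1 hw hμ (h.1.mono (Set.Icc_subset_Icc_right ht.2)) j
  rwa [intervalIntegrable_iff_integrableOn_Ioc_of_le ht.1] at this

/-- A trajectory is described by its coordinates. -/
theorem isTrajectory_of_apply {p : SwitchingLQ n k M} {x : Fin n → ℝ} {T : ℝ}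
    {w : ℝ → Fin k → ℝ} (hw : IsDisturbance w) {μ : ℝ → Fin M} (hμ : Measurable μ)
    {ξ : ℝ → Fin n → ℝ} (hc : ContinuousOn ξ (Set.Icc 0 T))
    (h : ∀ t ∈ Set.Icc 0 T, ∀ i, ξ t i =
      x i + ∫ s in (0 : ℝ)..t, (p.A (μ s) *ᵥ ξ s + p.sig (μ s) *ᵥ w s) i) :
    p.IsTrajectory x T w μ ξ := by
  refine ⟨hc, fun t ht => funext fun i => ?_⟩
  rw [h t ht, Pi.add_apply, intervalIntegral.integral_of_le ht.1,
    intervalIntegral.integral_of_le ht.1, eval_integral]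
  intro j
  have := p.intervalIntegrable_drift ht.1 hw hμ (hc.mono (Set.Icc_subset_Icc_right ht.2)) j
  rwa [intervalIntegrable_iff_integrableOn_Ioc_of_le ht.1] at this

theorem IsTrajectory.initial {p : SwitchingLQ n k M} {x : Fin n → ℝ} {T : ℝ} (hT : 0 ≤ T)
    {w : ℝ → Fin k → ℝ} {μ : ℝ → Fin M}
    {ξ : ℝ → Fin n → ℝ} (h : p.IsTrajectory x T w μ ξ) : ξ 0 = x := by
  simpa using h.2 0 ⟨le_rfl, hT⟩

/-- The energy balance of a trajectory against a time dependent quadratic form. -/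
theorem IsTrajectory.balance {p : SwitchingLQ n k M} {x : Fin n → ℝ} {T : ℝ} (hT : 0 ≤ T)
    {w : ℝ → Fin k → ℝ} (hw : IsDisturbance w) {μ : ℝ → Fin M} (hμ : Measurable μ)
    {ξ : ℝ → Fin n → ℝ} (h : p.IsTrajectory x T w μ ξ) {P P' : ℝ → Matrix (Fin n) (Fin n) ℝ}
    (hP : ∀ i j, HasACDeriv T (fun t => P t i j) (fun t => P' t i j)) :
    p.running T w μ ξ + (1 / 2) * (ξ T ⬝ᵥ (P T *ᵥ ξ T)) =
      (1 / 2) * (x ⬝ᵥ (P 0 *ᵥ x)) + ∫ t in (0 : ℝ)..T,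
        ((1 / 2) * ((p.A (μ t) *ᵥ ξ t + p.sig (μ t) *ᵥ w t) ⬝ᵥ (P t *ᵥ ξ t) +
          ξ t ⬝ᵥ (P' t *ᵥ ξ t) +
          ξ t ⬝ᵥ (P t *ᵥ (p.A (μ t) *ᵥ ξ t + p.sig (μ t) *ᵥ w t))) +
        ((1 / 2) * (ξ t ⬝ᵥ (p.D (μ t) *ᵥ ξ t)) - p.γ ^ 2 / 2 * (w t ⬝ᵥ w t))) := by
  set v : ℝ → Fin n → ℝ := fun s => p.A (μ s) *ᵥ ξ s + p.sig (μ s) *ᵥ w s with hv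
  -- Nothing is known of `ξ` outside `[0, T]`. The integral formula defines a function on all of `ℝ`
  -- which agrees with `ξ` there and is absolutely continuous with derivative `v`.
  set ζ : ℝ → Fin n → ℝ := fun t i => x i + ∫ s in (0 : ℝ)..t, v s i with hζ
  have hζξ : ∀ t ∈ Set.Icc 0 T, ξ t = ζ t := fun t ht =>
    funext fun i => h.apply_eq hw hμ ht i
  have hq := HasACDeriv.quadratic (ξ := ζ) (ξ' := v)
    (fun i => HasACDeriv.of_integral (x i) (p.intervalIntegrable_drift hT hw hμ h.1 i)) hP
  have h0 : ζ 0 = x := by simp [hζ]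
  rw [hζξ T ⟨hT, le_rfl⟩, intervalIntegral.integral_congr (g := fun t =>
    (1 / 2) * (v t ⬝ᵥ (P t *ᵥ ζ t) + ζ t ⬝ᵥ (P' t *ᵥ ζ t) + ζ t ⬝ᵥ (P t *ᵥ v t)) +
        ((1 / 2) * (ξ t ⬝ᵥ (p.D (μ t) *ᵥ ξ t)) - p.γ ^ 2 / 2 * (w t ⬝ᵥ w t))),
    intervalIntegral.integral_add (hq.intervalIntegrable.const_mul _)
      (p.intervalIntegrable_payoff hT hw hμ h.1), intervalIntegral.integral_const_mul,
    hq.integral_eq_sub, h0, running]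
  · ring
  · intro t ht
    rw [Set.uIcc_of_le hT] at ht
    simp only [hv, hζξ t ht]

end SwitchingLQ

/-! ### Quadratic forms and the Riccati operator -/

/-- The quadratic form `½ x' P x`. -/
noncomputable def quadForm {n : ℕ} (P : Matrix (Fin n) (Fin n) ℝ) (x : Fin n → ℝ) : ℝ :=
  (1 / 2) * (x ⬝ᵥ (P *ᵥ x))

theorem quadFun_eq_coe {n : ℕ} (P : Matrix (Fin n) (Fin n) ℝ) (x : Fin n → ℝ) :
    quadFun P x = (quadForm P x : EReal) := rfl

/-- The Riccati operator `P ↦ A'P + PA + PSP + D`. -/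
def riccati {n : ℕ} (A D S P : Matrix (Fin n) (Fin n) ℝ) : Matrix (Fin n) (Fin n) ℝ :=
  Aᵀ * P + P * A + P * S * P + D

section Forms

variable {n k : ℕ}

theorem dotProduct_self_nonneg' (x : Fin n → ℝ) : 0 ≤ x ⬝ᵥ x :=
  Finset.sum_nonneg fun _ _ => mul_self_nonneg _

theorem dotProduct_mulVec_transpose (B : Matrix (Fin n) (Fin k) ℝ) (x : Fin n → ℝ)
    (y : Fin k → ℝ) : x ⬝ᵥ (B *ᵥ y) = (Bᵀ *ᵥ x) ⬝ᵥ y := by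
  rw [Matrix.dotProduct_mulVec, Matrix.mulVec_transpose]

theorem Matrix.IsSymm.dotProduct_mulVec_comm {P : Matrix (Fin n) (Fin n) ℝ} (hP : P.IsSymm)
    (x y : Fin n → ℝ) : x ⬝ᵥ (P *ᵥ y) = (P *ᵥ x) ⬝ᵥ y := by
  rw [dotProduct_mulVec_transpose, hP.eq]

/-- `0 ≤ P ≤ ρ I` for a symmetric matrix `P`. -/
structure SymmBetween (P : Matrix (Fin n) (Fin n) ℝ) (ρ : ℝ) : Prop where
  symm : P.IsSymm
  nonneg : ∀ x, 0 ≤ x ⬝ᵥ (P *ᵥ x)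
  le : ∀ x, x ⬝ᵥ (P *ᵥ x) ≤ ρ * (x ⬝ᵥ x)

/-- This is `P² ≤ ρP` without spectral theory: expand `y'Py ≥ 0` at `y = x - Px/ρ` and bound the
last term by `P ≤ ρI` applied to `Px`. -/
theorem SymmBetween.mulVec_sq_le {P : Matrix (Fin n) (Fin n) ℝ} {ρ : ℝ} (hP : SymmBetween P ρ)
    (hρ : 0 < ρ) (x : Fin n → ℝ) : (P *ᵥ x) ⬝ᵥ (P *ᵥ x) ≤ ρ ^ 2 * (x ⬝ᵥ x) := by
  have h := hP.nonneg (x - (1 / ρ) • (P *ᵥ x))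
  have h1 := hP.le (P *ᵥ x)
  have h2 := hP.le x
  rw [Matrix.mulVec_sub, Matrix.mulVec_smul, sub_dotProduct, dotProduct_sub, dotProduct_sub,
    smul_dotProduct, dotProduct_smul, smul_dotProduct, dotProduct_smul,
    hP.symm.dotProduct_mulVec_comm x (P *ᵥ x)] at h
  simp only [smul_eq_mul] at h
  set a := x ⬝ᵥ (P *ᵥ x)
  set b := (P *ᵥ x) ⬝ᵥ (P *ᵥ x)
  set c := (P *ᵥ x) ⬝ᵥ (P *ᵥ (P *ᵥ x))
  have h3 : (1 / ρ) * ((1 / ρ) * c) ≤ (1 / ρ) * b := by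
    have : (1 / ρ) * c ≤ b := by
      rw [one_div, inv_mul_le_iff₀ hρ]; exact h1
    exact mul_le_mul_of_nonneg_left this (by positivity)
  have h4 : (1 / ρ) * b ≤ a := by linarith
  rw [one_div, inv_mul_le_iff₀ hρ] at h4
  nlinarith

/-- Expand `|y - c⁻¹BB'y|² ≥ 0` and bound the last term by the hypothesis at `w = B'y`. -/
theorem transpose_mulVec_sq_le {B : Matrix (Fin n) (Fin k) ℝ} {c : ℝ} (hc : 0 < c)
    (hB : ∀ w, (B *ᵥ w) ⬝ᵥ (B *ᵥ w) ≤ c * (w ⬝ᵥ w)) (y : Fin n → ℝ) :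
    (Bᵀ *ᵥ y) ⬝ᵥ (Bᵀ *ᵥ y) ≤ c * (y ⬝ᵥ y) := by
  have h := dotProduct_self_nonneg' (y - (1 / c) • (B *ᵥ (Bᵀ *ᵥ y)))
  have h1 := hB (Bᵀ *ᵥ y)
  rw [sub_dotProduct, dotProduct_sub, dotProduct_sub, dotProduct_comm (_ • _) y, dotProduct_smul,
    dotProduct_smul, smul_dotProduct, dotProduct_mulVec_transpose B y] at h
  simp only [smul_eq_mul] at h
  set a := (Bᵀ *ᵥ y) ⬝ᵥ (Bᵀ *ᵥ y)
  set b := (B *ᵥ (Bᵀ *ᵥ y)) ⬝ᵥ (B *ᵥ (Bᵀ *ᵥ y))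
  have h3 : (1 / c) * ((1 / c) * b) ≤ (1 / c) * a := by
    have : (1 / c) * b ≤ a := by
      rw [one_div, inv_mul_le_iff₀ hc]; exact h1
    exact mul_le_mul_of_nonneg_left this (by positivity)
  have h4 : (1 / c) * a ≤ y ⬝ᵥ y := by linarith
  rwa [one_div, inv_mul_le_iff₀ hc] at h4

theorem isSymm_riccati {A D S P : Matrix (Fin n) (Fin n) ℝ} (hD : D.IsSymm) (hS : S.IsSymm)
    (hP : P.IsSymm) : (riccati A D S P).IsSymm := by
  simp only [riccati, Matrix.IsSymm, Matrix.transpose_add, Matrix.transpose_mul,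
    Matrix.transpose_transpose, hD.eq, hS.eq, hP.eq, Matrix.mul_assoc]
  abel

theorem dotProduct_riccati {A D S P : Matrix (Fin n) (Fin n) ℝ} (hP : P.IsSymm)
    (x : Fin n → ℝ) :
    x ⬝ᵥ (riccati A D S P *ᵥ x) =
      2 * ((P *ᵥ x) ⬝ᵥ (A *ᵥ x)) + (P *ᵥ x) ⬝ᵥ (S *ᵥ (P *ᵥ x)) + x ⬝ᵥ (D *ᵥ x) := by
  simp only [riccati, Matrix.add_mulVec, dotProduct_add, ← Matrix.mulVec_mulVec]
  rw [dotProduct_mulVec_transpose Aᵀ, Matrix.transpose_transpose,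
    hP.dotProduct_mulVec_comm x (A *ᵥ x), hP.dotProduct_mulVec_comm x (S *ᵥ _),
    dotProduct_comm (A *ᵥ x)]
  ring

/-! ### Operator norm bounds for the Riccati operator -/

open scoped Matrix.Norms.L2Operator

theorem dotProduct_mulVec_le_norm (B : Matrix (Fin n) (Fin n) ℝ) (x : Fin n → ℝ) :
    |x ⬝ᵥ (B *ᵥ x)| ≤ ‖B‖ * (x ⬝ᵥ x) := by
  have h1 := B.l2_opNorm_mulVec (WithLp.toLp 2 x)
  have h2 := abs_real_inner_le_norm (WithLp.toLp 2 x) (WithLp.toLp 2 (B *ᵥ x))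
  have h3 : inner ℝ (WithLp.toLp 2 x) (WithLp.toLp 2 (B *ᵥ x)) = x ⬝ᵥ (B *ᵥ x) := by
    rw [EuclideanSpace.inner_eq_star_dotProduct]
    simp [dotProduct_comm]
  have h4 : ‖WithLp.toLp 2 x‖ * ‖WithLp.toLp 2 x‖ = x ⬝ᵥ x := by
    rw [← real_inner_self_eq_norm_mul_norm, EuclideanSpace.inner_eq_star_dotProduct]
    simp
  rw [h3] at h2
  calc _ ≤ _ := h2
    _ ≤ ‖WithLp.toLp 2 x‖ * (‖B‖ * ‖WithLp.toLp 2 x‖) := by gcongr; exact h1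
    _ = ‖B‖ * (x ⬝ᵥ x) := by rw [← h4]; ring

theorem l2_norm_le_of_mulVec_sq_le {B : Matrix (Fin n) (Fin n) ℝ} {c : ℝ} (hc : 0 ≤ c)
    (h : ∀ x, (B *ᵥ x) ⬝ᵥ (B *ᵥ x) ≤ c ^ 2 * (x ⬝ᵥ x)) : ‖B‖ ≤ c := by
  rw [Matrix.cstar_norm_def]
  refine ContinuousLinearMap.opNorm_le_bound _ hc fun x => ?_
  have e : ∀ y : EuclideanSpace ℝ (Fin n), ‖y‖ ^ 2 = y.ofLp ⬝ᵥ y.ofLp := by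
    intro y
    rw [← real_inner_self_eq_norm_sq, EuclideanSpace.inner_eq_star_dotProduct]
    simp
  refine abs_le_of_sq_le_sq' ?_ (by positivity) |>.2
  rw [mul_pow, e, e]
  exact h x.ofLp

theorem SymmBetween.norm_le {P : Matrix (Fin n) (Fin n) ℝ} {ρ : ℝ} (hP : SymmBetween P ρ)
    (hρ : 0 < ρ) : ‖P‖ ≤ ρ :=
  l2_norm_le_of_mulVec_sq_le hρ.le (hP.mulVec_sq_le hρ)

theorem l2_norm_one_le : ‖(1 : Matrix (Fin n) (Fin n) ℝ)‖ ≤ 1 :=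
  l2_norm_le_of_mulVec_sq_le zero_le_one (by simp)

theorem l2_norm_transpose (B : Matrix (Fin n) (Fin n) ℝ) : ‖Bᵀ‖ = ‖B‖ := by
  rw [← Matrix.conjTranspose_eq_transpose_of_trivial, Matrix.l2_opNorm_conjTranspose]

theorem norm_riccati_le {A D S P : Matrix (Fin n) (Fin n) ℝ} {a d s ρ : ℝ} (hA : ‖A‖ ≤ a)
    (hD : ‖D‖ ≤ d) (hS : ‖S‖ ≤ s) (hP : ‖P‖ ≤ ρ) :
    ‖riccati A D S P‖ ≤ a * ρ + ρ * a + ρ * s * ρ + d := by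
  have ha := (norm_nonneg A).trans hA
  have hs := (norm_nonneg S).trans hS
  have hr := (norm_nonneg P).trans hP
  unfold riccati
  refine (norm_add_le _ _).trans (add_le_add ((norm_add₃_le).trans
    (add_le_add (add_le_add ?_ ?_) ?_)) hD)
  · exact (norm_mul_le _ _).trans (by rw [l2_norm_transpose]; gcongr)
  · exact (norm_mul_le _ _).trans (by gcongr)
  · exact (norm_mul_le _ _).trans (by grw [norm_mul_le]; gcongr)

/-- The Riccati operator is quadratic, so the difference has an exact expansion with linear and
quadratic terms in `E`. It controls the remainder of the one-step expansion. -/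
theorem norm_riccati_add_sub_le {A D S P E : Matrix (Fin n) (Fin n) ℝ} {a s ρ η : ℝ}
    (hA : ‖A‖ ≤ a) (hS : ‖S‖ ≤ s) (hP : ‖P‖ ≤ ρ) (hE : ‖E‖ ≤ η) :
    ‖riccati A D S (P + E) - riccati A D S P‖ ≤ (2 * a + 2 * (ρ * s)) * η + s * η ^ 2 := by
  have ha := (norm_nonneg A).trans hA
  have hs := (norm_nonneg S).trans hS
  have hr := (norm_nonneg P).trans hP
  have he := (norm_nonneg E).trans hE
  have h1 : riccati A D S (P + E) - riccati A D S P =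
      Aᵀ * E + E * A + P * S * E + E * S * P + E * S * E := by
    simp only [riccati]; noncomm_ring
  have e1 : ‖Aᵀ * E‖ ≤ a * η := (norm_mul_le _ _).trans (by rw [l2_norm_transpose]; gcongr)
  have e2 : ‖E * A‖ ≤ η * a := (norm_mul_le _ _).trans (by gcongr)
  have e3 : ‖P * S * E‖ ≤ ρ * s * η :=
    (norm_mul_le _ _).trans (by grw [norm_mul_le]; gcongr)
  have e4 : ‖E * S * P‖ ≤ η * s * ρ :=
    (norm_mul_le _ _).trans (by grw [norm_mul_le]; gcongr)
  have e5 : ‖E * S * E‖ ≤ η * s * η :=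
    (norm_mul_le _ _).trans (by grw [norm_mul_le]; gcongr)
  rw [h1]
  refine (norm_add_le _ _).trans ((add_le_add ((norm_add_le _ _).trans (add_le_add
    ((norm_add₃_le).trans (add_le_add (add_le_add e1 e2) e3)) e4)) e5).trans (le_of_eq ?_))
  ring

end Forms

/-! ### Verification inequalities -/

theorem quadForm_add {n : ℕ} (P Q : Matrix (Fin n) (Fin n) ℝ) (x : Fin n → ℝ) :
    quadForm (P + Q) x = quadForm P x + quadForm Q x := by
  simp only [quadForm, Matrix.add_mulVec, dotProduct_add]; ring

theorem quadForm_smul {n : ℕ} (c : ℝ) (P : Matrix (Fin n) (Fin n) ℝ) (x : Fin n → ℝ) :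
    quadForm (c • P) x = c * quadForm P x := by
  simp only [quadForm, Matrix.smul_mulVec, dotProduct_smul, smul_eq_mul]; ring

theorem quadForm_one {n : ℕ} (x : Fin n → ℝ) :
    quadForm (1 : Matrix (Fin n) (Fin n) ℝ) x = (1 / 2) * (x ⬝ᵥ x) := by
  simp [quadForm]

theorem quadForm_sum {n : ℕ} {ι : Type*} (s : Finset ι) (P : ι → Matrix (Fin n) (Fin n) ℝ)
    (x : Fin n → ℝ) : quadForm (∑ i ∈ s, P i) x = ∑ i ∈ s, quadForm (P i) x := by
  classical
  induction s using Finset.induction_on with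
  | empty => simp [quadForm]
  | insert a s ha ih => rw [Finset.sum_insert ha, quadForm_add, ih, Finset.sum_insert ha]

namespace SwitchingLQ

variable {n k M : ℕ}

/-- The matrix `Σᵐ = γ⁻² σᵐ (σᵐ)'`. -/
noncomputable def S (p : SwitchingLQ n k M) (m : Fin M) : Matrix (Fin n) (Fin n) ℝ :=
  (1 / p.γ ^ 2) • (p.sig m * (p.sig m)ᵀ)

/-- The Riccati operator of the index `m`. -/
noncomputable def ric (p : SwitchingLQ n k M) (m : Fin M) (P : Matrix (Fin n) (Fin n) ℝ) :
    Matrix (Fin n) (Fin n) ℝ :=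
  riccati (p.A m) (p.D m) (p.S m) P

theorem isSymm_S (p : SwitchingLQ n k M) (m : Fin M) : (p.S m).IsSymm := by
  simp [S, Matrix.IsSymm, Matrix.transpose_smul, Matrix.transpose_mul]

theorem dotProduct_S (p : SwitchingLQ n k M) (m : Fin M) (y : Fin n → ℝ) :
    y ⬝ᵥ (p.S m *ᵥ y) = 1 / p.γ ^ 2 * (((p.sig m)ᵀ *ᵥ y) ⬝ᵥ ((p.sig m)ᵀ *ᵥ y)) := by
  rw [S, Matrix.smul_mulVec, dotProduct_smul, smul_eq_mul, ← Matrix.mulVec_mulVec,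
    dotProduct_mulVec_transpose (p.sig m)]

/-- What is used of the assumptions on the data: `lam I` is a strict supersolution of all
Riccati equations, and `D - PΣP` is positive definite for `0 ≤ P ≤ lam I`. -/
structure CoreBounds (p : SwitchingLQ n k M) (cA β cD mD lam : ℝ) : Prop where
  γ_pos : 0 < p.γ
  cA_pos : 0 < cA
  β_pos : 0 < β
  lam_pos : 0 < lam
  stable : ∀ (m : Fin M) (x : Fin n → ℝ), x ⬝ᵥ (p.A m *ᵥ x) ≤ -cA * (x ⬝ᵥ x)
  sig_le : ∀ (m : Fin M) (w : Fin k → ℝ),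
    (p.sig m *ᵥ w) ⬝ᵥ (p.sig m *ᵥ w) ≤ β * p.γ ^ 2 * (w ⬝ᵥ w)
  D_symm : ∀ m : Fin M, (p.D m).IsSymm
  D_le : ∀ (m : Fin M) (x : Fin n → ℝ), x ⬝ᵥ (p.D m *ᵥ x) ≤ cD * (x ⬝ᵥ x)
  le_D : ∀ (m : Fin M) (x : Fin n → ℝ), mD * (x ⬝ᵥ x) ≤ x ⬝ᵥ (p.D m *ᵥ x)
  strict : -2 * cA * lam + β * lam ^ 2 + cD < 0
  lt_mD : β * lam ^ 2 < mD

variable {p : SwitchingLQ n k M} {cA β cD mD lam : ℝ}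

theorem CoreBounds.S_nonneg (h : p.CoreBounds cA β cD mD lam) (m : Fin M) (y : Fin n → ℝ) :
    0 ≤ y ⬝ᵥ (p.S m *ᵥ y) := by
  have := h.γ_pos
  rw [dotProduct_S]
  exact mul_nonneg (by positivity) (dotProduct_self_nonneg' _)

theorem CoreBounds.S_le (h : p.CoreBounds cA β cD mD lam) (m : Fin M) (y : Fin n → ℝ) :
    y ⬝ᵥ (p.S m *ᵥ y) ≤ β * (y ⬝ᵥ y) := by
  have hγ := h.γ_pos
  have hβ := h.β_pos
  rw [dotProduct_S]
  have := transpose_mulVec_sq_le (by positivity) (h.sig_le m) y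
  rw [one_div, inv_mul_le_iff₀ (by positivity)]
  linarith

/-- The density is a concave quadratic in `w`, maximal at the feedback `w = γ⁻²σ'Px`. The maximum is
the Riccati expression and the defect is the square of the distance to the maximiser. -/
theorem completed_square (hγ : p.γ ≠ 0) (m : Fin M) {P : Matrix (Fin n) (Fin n) ℝ}
    (hP : P.IsSymm) (P' : Matrix (Fin n) (Fin n) ℝ) (x : Fin n → ℝ) (w : Fin k → ℝ) :
    (1 / 2) * ((p.A m *ᵥ x + p.sig m *ᵥ w) ⬝ᵥ (P *ᵥ x) + x ⬝ᵥ (P' *ᵥ x) +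
        x ⬝ᵥ (P *ᵥ (p.A m *ᵥ x + p.sig m *ᵥ w))) +
      ((1 / 2) * (x ⬝ᵥ (p.D m *ᵥ x)) - p.γ ^ 2 / 2 * (w ⬝ᵥ w)) =
    (1 / 2) * (x ⬝ᵥ (P' *ᵥ x) + x ⬝ᵥ (p.ric m P *ᵥ x)) -
      p.γ ^ 2 / 2 * ((w - (1 / p.γ ^ 2) • ((p.sig m)ᵀ *ᵥ (P *ᵥ x))) ⬝ᵥ
        (w - (1 / p.γ ^ 2) • ((p.sig m)ᵀ *ᵥ (P *ᵥ x)))) := by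
  rw [ric, dotProduct_riccati hP, dotProduct_S, hP.dotProduct_mulVec_comm x (_ + _),
    dotProduct_comm (_ + _) (P *ᵥ x), dotProduct_add, dotProduct_mulVec_transpose (p.sig m)]
  set z := (p.sig m)ᵀ *ᵥ (P *ᵥ x)
  rw [sub_dotProduct, dotProduct_sub, dotProduct_sub, dotProduct_smul, smul_dotProduct,
    smul_dotProduct, dotProduct_smul, dotProduct_comm w z]
  simp only [smul_eq_mul]
  field_simp
  ring

theorem payoff_density_le (hγ : p.γ ≠ 0) (m : Fin M) {P : Matrix (Fin n) (Fin n) ℝ}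
    (hP : P.IsSymm) (P' : Matrix (Fin n) (Fin n) ℝ) (x : Fin n → ℝ) (w : Fin k → ℝ) :
    (1 / 2) * ((p.A m *ᵥ x + p.sig m *ᵥ w) ⬝ᵥ (P *ᵥ x) + x ⬝ᵥ (P' *ᵥ x) +
        x ⬝ᵥ (P *ᵥ (p.A m *ᵥ x + p.sig m *ᵥ w))) +
      ((1 / 2) * (x ⬝ᵥ (p.D m *ᵥ x)) - p.γ ^ 2 / 2 * (w ⬝ᵥ w)) ≤
    (1 / 2) * (x ⬝ᵥ (P' *ᵥ x) + x ⬝ᵥ (p.ric m P *ᵥ x)) := by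
  rw [completed_square hγ m hP]
  have := mul_nonneg (by positivity : 0 ≤ p.γ ^ 2 / 2) (dotProduct_self_nonneg'
    (w - (1 / p.γ ^ 2) • ((p.sig m)ᵀ *ᵥ (P *ᵥ x))))
  linarith

/-- A time dependent supersolution of the Riccati equation bounds the payoff from above. -/
theorem IsTrajectory.payoff_le {x : Fin n → ℝ} {T : ℝ} (hγ : p.γ ≠ 0) (hT : 0 ≤ T)
    {w : ℝ → Fin k → ℝ} (hw : IsDisturbance w) {μ : ℝ → Fin M} (hμ : Measurable μ)
    {ξ : ℝ → Fin n → ℝ} (h : p.IsTrajectory x T w μ ξ) {P P' : ℝ → Matrix (Fin n) (Fin n) ℝ}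
    (hP : ∀ i j, HasACDeriv T (fun t => P t i j) (fun t => P' t i j))
    (hs : ∀ t ∈ Set.Icc 0 T, (P t).IsSymm)
    (hsup : ∀ t ∈ Set.Icc 0 T, ∀ y, y ⬝ᵥ (P' t *ᵥ y) + y ⬝ᵥ (p.ric (μ t) (P t) *ᵥ y) ≤ 0) :
    p.running T w μ ξ + quadForm (P T) (ξ T) ≤ quadForm (P 0) x := by
  rw [quadForm, h.balance hT hw hμ hP, quadForm, add_le_iff_nonpos_right]
  rw [← neg_nonneg, ← intervalIntegral.integral_neg]
  refine intervalIntegral.integral_nonneg hT fun t ht => ?_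
  have := payoff_density_le (p := p) hγ (μ t) (hs t ht) (P' t) (ξ t) (w t)
  have := hsup t ht (ξ t)
  linarith

/-- `lam I` is a strict supersolution. -/
theorem CoreBounds.payoff_le_lam (h : p.CoreBounds cA β cD mD lam) {κ T : ℝ} (hκ : 0 ≤ κ)
    (hT : 0 ≤ T) (hκT : κ * T ≤ 1)
    (hκπ : lam * κ * (1 + 2 * cA * T) + (-2 * cA * lam + β * lam ^ 2 + cD) ≤ 0)
    {x : Fin n → ℝ} {w : ℝ → Fin k → ℝ} (hw : IsDisturbance w) {μ : ℝ → Fin M}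
    (hμ : Measurable μ) {ξ : ℝ → Fin n → ℝ} (hξ : p.IsTrajectory x T w μ ξ) :
    p.running T w μ ξ + quadForm (lam • 1) (ξ T) ≤ (1 - κ * T) * quadForm (lam • 1) x := by
  have hcA := h.cA_pos
  have hβ := h.β_pos
  have hl := h.lam_pos
  -- The coefficient rises linearly from `lam (1 - κT)` to `lam`. The slope `lam κ` is paid for by
  -- the strict negativity of `-2 cA lam + β lam² + cD`; the term `2 cA T` in `hκπ` accounts for the
  -- damping lost when `lam` is replaced by a smaller coefficient.
  have key := hξ.payoff_le (P := fun t => (lam * (1 - κ * (T - t))) • 1)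
    (P' := fun _ => (lam * κ) • 1) h.γ_pos.ne' hT hw hμ ?_ ?_ ?_
  · simpa [quadForm_smul, mul_assoc, mul_left_comm] using key
  · intro i j
    refine HasACDeriv.of_hasDerivAt (fun t => ?_) continuous_const
    simp only [Matrix.smul_apply, smul_eq_mul]
    have : HasDerivAt (fun t : ℝ => lam * (1 - κ * (T - t))) (lam * κ) t := by
      have := (((hasDerivAt_id t).const_sub T).const_mul κ).const_sub 1 |>.const_mul lam
      simpa using this
    exact this.mul_const _
  · intro t _
    exact Matrix.isSymm_one.smul _
  · intro t ht y
    set q := lam * (1 - κ * (T - t)) with hq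
    have hs0 : 0 ≤ κ * (T - t) := mul_nonneg hκ (by linarith [ht.2])
    have hs1 : κ * (T - t) ≤ κ * T := mul_le_mul_of_nonneg_left (by linarith [ht.1]) hκ
    have hq0 : 0 ≤ q := mul_nonneg hl.le (by linarith)
    have hq1 : q ≤ lam := by nlinarith
    have hy := dotProduct_self_nonneg' y
    rw [ric, dotProduct_riccati (Matrix.isSymm_one.smul _)]
    simp only [Matrix.smul_mulVec, Matrix.one_mulVec, dotProduct_smul, smul_dotProduct,
      smul_eq_mul, Matrix.mulVec_smul]
    have h1 := mul_le_mul_of_nonneg_left (h.stable (μ t) y) (by positivity : 0 ≤ 2 * q)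
    have h2 := mul_le_mul_of_nonneg_left (h.S_le (μ t) y) (by positivity : 0 ≤ q * q)
    have h3 := h.D_le (μ t) y
    have h4 : lam * κ + -2 * cA * q + β * q ^ 2 + cD ≤ 0 := by
      have : β * q ^ 2 ≤ β * lam ^ 2 := by gcongr
      have : lam * (cA * (κ * (T - t))) ≤ lam * (cA * (κ * T)) := by gcongr
      rw [hq] at *
      nlinarith
    nlinarith [mul_le_mul_of_nonneg_right h4 hy]

/-- `κ` is a fraction of the strict margin, chosen uniformly for all horizons `T ≤ 1`. -/
theorem CoreBounds.exists_rate (h : p.CoreBounds cA β cD mD lam) :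
    ∃ κ : ℝ, 0 < κ ∧ κ ≤ 1 ∧
      lam * κ * (1 + 2 * cA) + (-2 * cA * lam + β * lam ^ 2 + cD) ≤ 0 := by
  have hcA := h.cA_pos
  have hl := h.lam_pos
  have hs := h.strict
  set d := -2 * cA * lam + β * lam ^ 2 + cD with hd
  refine ⟨min 1 (-d / (lam * (1 + 2 * cA))), lt_min one_pos (div_pos (by linarith)
    (by positivity)), min_le_left _ _, ?_⟩
  have := min_le_right 1 (-d / (lam * (1 + 2 * cA)))
  rw [le_div_iff₀ (by positivity)] at this
  linarith

/-- The time during which `μ` takes the value `m` in `[t, T]`. -/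
noncomputable def occupation (T : ℝ) (μ : ℝ → Fin M) (m : Fin M) (t : ℝ) : ℝ :=
  ∫ s in t..T, if μ s = m then 1 else 0

section Occupation

variable {T : ℝ} {μ : ℝ → Fin M}

theorem hasACDeriv_occupation (hμ : Measurable μ) (m : Fin M) :
    HasACDeriv T (occupation T μ m) (fun t => -if μ t = m then 1 else 0) := by
  have hi := intervalIntegrable_comp_index hμ fun j => if j = m then (1 : ℝ) else 0
  have := HasACDeriv.of_integral (T := T) (occupation T μ m 0)
    (f' := fun t => -if μ t = m then 1 else 0) (hi 0 T).neg
  convert this using 1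
  funext t
  rw [intervalIntegral.integral_neg, occupation, occupation,
    ← intervalIntegral.integral_add_adjacent_intervals (hi 0 t) (hi t T)]
  ring

theorem occupation_nonneg {t : ℝ} (ht : t ≤ T) (m : Fin M) : 0 ≤ occupation T μ m t :=
  intervalIntegral.integral_nonneg ht fun s _ => by split_ifs <;> norm_num

theorem sum_occupation (hμ : Measurable μ) (t : ℝ) : ∑ m, occupation T μ m t = T - t := by
  simp only [occupation]
  rw [← intervalIntegral.integral_finsetSum fun m _ =>
    intervalIntegrable_comp_index hμ (fun j => if j = m then (1 : ℝ) else 0) t T]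
  simp

end Occupation

end SwitchingLQ

namespace SwitchingLQ

variable {n k M : ℕ} {p : SwitchingLQ n k M} {cA β cD mD lam : ℝ}

/-! ### Feedback trajectories -/

theorem isDisturbance_of_continuous {w : ℝ → Fin k → ℝ} (hw : Continuous w) :
    IsDisturbance w := fun _ =>
  ⟨hw.aestronglyMeasurable, (hw.dotProduct hw).integrableOn_Icc⟩

/-- A constant index together with a linear feedback produces a trajectory. -/
theorem exists_feedback (p : SwitchingLQ n k M) (m : Fin M) (G : Matrix (Fin k) (Fin n) ℝ)
    (x : Fin n → ℝ) : ∃ ξ : ℝ → Fin n → ℝ, Continuous ξ ∧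
      ∀ T, p.IsTrajectory x T (fun t => G *ᵥ ξ t) (fun _ => m) ξ := by
  let B : (Fin n → ℝ) →L[ℝ] (Fin n → ℝ) :=
    (Matrix.mulVecLin (p.A m + p.sig m * G)).toContinuousLinearMap
  have hB : ∀ y, B y = p.A m *ᵥ y + p.sig m *ᵥ (G *ᵥ y) := by
    intro y
    simp [B, Matrix.mulVec_mulVec]
  let ξ : ℝ → Fin n → ℝ := fun t => NormedSpace.exp (t • B) x
  have hd : ∀ t, HasDerivAt ξ (B (ξ t)) t := by
    intro t
    have h := (hasDerivAt_exp_smul_const' (𝕂 := ℝ) B t)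
    exact ((ContinuousLinearMap.apply ℝ (Fin n → ℝ) x).hasFDerivAt.comp_hasDerivAt t h)
  have hc : Continuous ξ := continuous_iff_continuousAt.2 fun t => (hd t).continuousAt
  refine ⟨ξ, hc, fun T => ⟨hc.continuousOn, fun t _ => ?_⟩⟩
  have h0 : ξ 0 = x := by simp [ξ]
  have := intervalIntegral.integral_eq_sub_of_hasDerivAt (a := 0) (b := t) (fun s _ => hd s)
    ((B.continuous.comp hc).intervalIntegrable _ _)
  simp only [hB] at this
  rw [this, h0]
  abel

/-! ### One-step estimates -/

theorem hasDerivAt_mul_sub_sq (T c t : ℝ) :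
    HasDerivAt (fun t : ℝ => c * (T - t) ^ 2) (-(2 * c * (T - t))) t := by
  refine ((((hasDerivAt_id t).const_sub T).fun_pow 2).const_mul c).congr_deriv ?_
  simp
  ring

open scoped Matrix.Norms.L2Operator

theorem norm_sq_smul_one_le {K u : ℝ} (hK : 0 ≤ K) (hu : 0 ≤ u) (hKu : K * u ≤ 1) :
    ‖(K * u ^ 2) • (1 : Matrix (Fin n) (Fin n) ℝ)‖ ≤ u := by
  rw [norm_smul, Real.norm_of_nonneg (by positivity)]
  calc K * u ^ 2 * ‖(1 : Matrix (Fin n) (Fin n) ℝ)‖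
      ≤ K * u ^ 2 * 1 := by gcongr; exact l2_norm_one_le
    _ = (K * u) * u := by ring
    _ ≤ 1 * u := by gcongr
    _ = u := one_mul u

theorem CoreBounds.isSymm_ric (h : p.CoreBounds cA β cD mD lam)
    {P : Matrix (Fin n) (Fin n) ℝ} (hP : P.IsSymm) (m : Fin M) : (p.ric m P).IsSymm :=
  isSymm_riccati (h.D_symm m) (p.isSymm_S m) hP

/-- The supersolution is `P + Σ_m θ_m(t) ric_m(P) + K(T - t)² I`, with `θ_m(t)` the occupation time
of `m` left in `[t, T]`. Differentiating the sum gives exactly `-ric_{μ_t}(P)`, however irregular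
`μ` is. What is left, `ric(P + E) - ric(P)` with `E = O(T - t)`, is absorbed by the derivative
`-2K(T - t)` of the quadratic term. -/
theorem CoreBounds.one_step_le (h : p.CoreBounds cA β cD mD lam) {a s ρ F K T : ℝ}
    (ha : ∀ m, ‖p.A m‖ ≤ a) (hs : ∀ m, ‖p.S m‖ ≤ s) (hs0 : 0 ≤ s) (hF0 : 0 ≤ F)
    (hK : 0 ≤ K) (hL : (2 * a + 2 * (ρ * s)) * (F + 1) + s * (F + 1) ^ 2 ≤ K)
    (hT : 0 ≤ T) (hT1 : T ≤ 1) (hKT : K * T ≤ 1)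
    {P : Matrix (Fin n) (Fin n) ℝ} (hP : P.IsSymm) (hPρ : ‖P‖ ≤ ρ)
    (hric : ∀ m, ‖p.ric m P‖ ≤ F) {x : Fin n → ℝ} {w : ℝ → Fin k → ℝ} {μ : ℝ → Fin M}
    {ξ : ℝ → Fin n → ℝ} (hw : IsDisturbance w) (hμ : Measurable μ)
    (hξ : p.IsTrajectory x T w μ ξ) :
    p.running T w μ ξ + quadForm P (ξ T) ≤ quadForm P x +
      ∑ m, occupation T μ m 0 * quadForm (p.ric m P) x + K * T ^ 2 * quadForm 1 x := by
  set E : ℝ → Matrix (Fin n) (Fin n) ℝ := fun t =>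
    (∑ m, occupation T μ m t • p.ric m P) + (K * (T - t) ^ 2) • 1 with hE
  have key := hξ.payoff_le (P := fun t => P + E t)
    (P' := fun t => -p.ric (μ t) P - (2 * K * (T - t)) • 1) h.γ_pos.ne' hT hw hμ
    ?_ ?_ ?_
  · have e1 : E T = 0 := by
      simp [hE, occupation]
    have e2 : quadForm (E 0) x =
        ∑ m, occupation T μ m 0 * quadForm (p.ric m P) x + K * T ^ 2 * quadForm 1 x := by
      simp [hE, quadForm_add, quadForm_sum, quadForm_smul]
    rw [e1, add_zero, quadForm_add, e2] at key
    linarith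
  · intro i j
    have h1 := HasACDeriv.sum (T := T) Finset.univ
      (f := fun m t => p.ric m P i j * occupation T μ m t) fun m _ =>
        (hasACDeriv_occupation hμ m).const_mul (p.ric m P i j)
    have h2 := HasACDeriv.of_hasDerivAt (T := T)
      (hasDerivAt_mul_sub_sq T (K * (1 : Matrix (Fin n) (Fin n) ℝ) i j)) (by fun_prop)
    have h3 := ((HasACDeriv.const (T := T) (P i j)).add (h1.add h2))
    convert h3 using 1
    · funext t
      simp only [hE, Matrix.add_apply, Matrix.sum_apply, Matrix.smul_apply, smul_eq_mul]
      congr 1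
      congr 1
      · exact Finset.sum_congr rfl fun m _ => mul_comm _ _
      · ring
    · funext t
      simp only [Matrix.sub_apply, Matrix.neg_apply, Matrix.smul_apply, smul_eq_mul]
      simp
      ring
  · intro t _
    refine hP.add (Matrix.IsSymm.add ?_ (Matrix.isSymm_one.smul _))
    rw [Matrix.IsSymm, Matrix.transpose_sum]
    exact Finset.sum_congr rfl fun m _ => (h.isSymm_ric hP m).smul _
  · intro t ht y
    set u := T - t with hu'
    have hu0 : 0 ≤ u := by linarith [ht.2]
    have hu2 : u ≤ 1 := by linarith [ht.1]
    have hu1 : K * u ≤ 1 := (mul_le_mul_of_nonneg_left (by linarith [ht.1]) hK).trans hKT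
    have hEn : ‖E t‖ ≤ u * (F + 1) := by
      have e1 : ‖∑ m, occupation T μ m t • p.ric m P‖ ≤ u * F := by
        rw [hu', ← sum_occupation hμ t, Finset.sum_mul]
        refine norm_sum_le_of_le _ fun m _ => ?_
        have := occupation_nonneg (μ := μ) ht.2 m
        rw [norm_smul, Real.norm_of_nonneg this]
        gcongr
        exact hric m
      have e2 := norm_sq_smul_one_le (n := n) hK hu0 hu1
      refine (norm_add_le _ _).trans ?_
      linarith
    have hn := norm_riccati_add_sub_le (D := p.D (μ t)) (ha (μ t)) (hs (μ t)) hPρ hEn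
    have hn2 : (2 * a + 2 * (ρ * s)) * (u * (F + 1)) + s * (u * (F + 1)) ^ 2 ≤ K * u := by
      have : s * (u * (F + 1)) ^ 2 ≤ s * (F + 1) ^ 2 * u := by
        have : u * u ≤ u := by nlinarith
        calc s * (u * (F + 1)) ^ 2 = s * (F + 1) ^ 2 * (u * u) := by ring
          _ ≤ _ := by gcongr
      nlinarith
    have hy := dotProduct_self_nonneg' y
    have h1 := (le_abs_self _).trans (dotProduct_mulVec_le_norm
      (riccati (p.A (μ t)) (p.D (μ t)) (p.S (μ t)) (P + E t) -
        riccati (p.A (μ t)) (p.D (μ t)) (p.S (μ t)) P) y)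
    have h2 := mul_le_mul_of_nonneg_right (hn.trans hn2) hy
    have h3 : 0 ≤ K * u * (y ⬝ᵥ y) := by positivity
    simp only [Matrix.sub_mulVec, Matrix.neg_mulVec, dotProduct_sub, dotProduct_neg,
      Matrix.smul_mulVec, Matrix.one_mulVec, dotProduct_smul, smul_eq_mul, ric] at h1 ⊢
    nlinarith

/-- The disturbance is the feedback `w = γ⁻²σ'Pξ` that is optimal for the frozen matrix `P`, so the
completed square vanishes. The correction `E` then enters the balance only linearly, through the
closed loop matrix `A + ΣP`. -/
theorem CoreBounds.exists_le_one_step (h : p.CoreBounds cA β cD mD lam) {a s ρ F K T : ℝ}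
    (ha : ∀ m, ‖p.A m‖ ≤ a) (hs : ∀ m, ‖p.S m‖ ≤ s) (ha0 : 0 ≤ a) (hs0 : 0 ≤ s) (hF0 : 0 ≤ F)
    (hK : 0 ≤ K) (hL : (2 * a + 2 * (ρ * s)) * (F + 1) + s * (F + 1) ^ 2 ≤ K)
    (hT : 0 ≤ T) (hT1 : T ≤ 1) (hKT : K * T ≤ 1)
    {P : Matrix (Fin n) (Fin n) ℝ} (hP : P.IsSymm) (hPρ : ‖P‖ ≤ ρ)
    (hric : ∀ m, ‖p.ric m P‖ ≤ F) (x : Fin n → ℝ) (m : Fin M) :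
    ∃ w ξ, IsDisturbance w ∧ p.IsTrajectory x T w (fun _ => m) ξ ∧
      quadForm P x + T * quadForm (p.ric m P) x - K * T ^ 2 * quadForm 1 x ≤
        p.running T w (fun _ => m) ξ + quadForm P (ξ T) := by
  obtain ⟨ξ, hc, hξ⟩ := p.exists_feedback m ((1 / p.γ ^ 2) • ((p.sig m)ᵀ * P)) x
  set w : ℝ → Fin k → ℝ := fun t => ((1 / p.γ ^ 2) • ((p.sig m)ᵀ * P)) *ᵥ ξ t with hwd
  have hw : IsDisturbance w := isDisturbance_of_continuous (continuous_const.matrix_mulVec hc)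
  refine ⟨w, ξ, hw, hξ T, ?_⟩
  set E : ℝ → Matrix (Fin n) (Fin n) ℝ := fun t =>
    (T - t) • p.ric m P - (K * (T - t) ^ 2) • 1 with hE
  have key := (hξ T).balance (P := fun t => P + E t)
    (P' := fun t => -p.ric m P + (2 * K * (T - t)) • 1) hT hw measurable_const ?_
  · have e1 : E T = 0 := by simp [hE]
    have e2 : quadForm (E 0) x = T * quadForm (p.ric m P) x -
        K * T ^ 2 * quadForm 1 x := by
      simp [hE, sub_eq_add_neg, quadForm_add, ← neg_smul, quadForm_smul]
    have e3 : (1 / 2) * (x ⬝ᵥ ((P + E 0) *ᵥ x)) = quadForm P x + quadForm (E 0) x := by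
      rw [← quadForm_add]; rfl
    rw [e3, e2, e1, add_zero] at key
    have e4 : quadForm P (ξ T) = (1 / 2) * (ξ T ⬝ᵥ (P *ᵥ ξ T)) := rfl
    rw [e4, key]
    suffices 0 ≤ ∫ t in (0 : ℝ)..T,
      ((1 / 2) * ((p.A m *ᵥ ξ t + p.sig m *ᵥ w t) ⬝ᵥ ((P + E t) *ᵥ ξ t) +
        ξ t ⬝ᵥ ((-p.ric m P + (2 * K * (T - t)) • 1) *ᵥ ξ t) +
        ξ t ⬝ᵥ ((P + E t) *ᵥ (p.A m *ᵥ ξ t + p.sig m *ᵥ w t))) +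
      ((1 / 2) * (ξ t ⬝ᵥ (p.D m *ᵥ ξ t)) - p.γ ^ 2 / 2 * (w t ⬝ᵥ w t))) by
        linarith
    refine intervalIntegral.integral_nonneg hT fun t ht => ?_
    set u := T - t with hu'
    have hu0 : 0 ≤ u := by linarith [ht.2]
    have hu2 : u ≤ 1 := by linarith [ht.1]
    have hu1 : K * u ≤ 1 := (mul_le_mul_of_nonneg_left (by linarith [ht.1]) hK).trans hKT
    have hEn : ‖E t‖ ≤ u * (F + 1) := by
      have e1 : ‖u • p.ric m P‖ ≤ u * F := by
        rw [norm_smul, Real.norm_of_nonneg hu0]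
        gcongr
        exact hric m
      have e2 := norm_sq_smul_one_le (n := n) hK hu0 hu1
      refine (norm_sub_le _ _).trans ?_
      linarith
    have hEs : (E t).IsSymm := ((h.isSymm_ric hP m).smul _).sub (Matrix.isSymm_one.smul _)
    have hsq := completed_square h.γ_pos.ne' m hP (-p.ric m P + (2 * K * u) • 1)
      (ξ t) (w t)
    have hw0 : w t - (1 / p.γ ^ 2) • ((p.sig m)ᵀ *ᵥ (P *ᵥ ξ t)) = 0 := by
      simp only [hwd, Matrix.smul_mulVec, Matrix.mulVec_mulVec, sub_self]
    have hv : p.A m *ᵥ ξ t + p.sig m *ᵥ w t = (p.A m + p.S m * P) *ᵥ ξ t := by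
      simp only [hwd, S, Matrix.smul_mulVec, Matrix.mulVec_smul, Matrix.add_mulVec,
        Matrix.mulVec_mulVec, Matrix.smul_mul, Matrix.mul_assoc]
    have hn : ‖E t * (p.A m + p.S m * P)‖ ≤ K * u := by
      have hρ := (norm_nonneg P).trans hPρ
      have e1 : ‖p.A m + p.S m * P‖ ≤ a + s * ρ := (norm_add_le _ _).trans
        (add_le_add (ha m) ((norm_mul_le _ _).trans (by gcongr; exact hs m)))
      calc _ ≤ _ := norm_mul_le _ _
        _ ≤ u * (F + 1) * (a + s * ρ) := by gcongr
        _ = (a + ρ * s) * (F + 1) * u := by ring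
        _ ≤ K * u := by
          have : 0 ≤ (a + ρ * s) * (F + 1) := by positivity
          have : 0 ≤ s * (F + 1) ^ 2 := by positivity
          gcongr
          linarith
    have h1 := (neg_le_abs _).trans (dotProduct_mulVec_le_norm
      (E t * (p.A m + p.S m * P)) (ξ t))
    have hy := dotProduct_self_nonneg' (ξ t)
    have h2 := mul_le_mul_of_nonneg_right hn hy
    have h3 : (p.A m *ᵥ ξ t + p.sig m *ᵥ w t) ⬝ᵥ (E t *ᵥ ξ t) =
        ξ t ⬝ᵥ (E t *ᵥ (p.A m *ᵥ ξ t + p.sig m *ᵥ w t)) := by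
      rw [hEs.dotProduct_mulVec_comm (ξ t), dotProduct_comm]
    have h4 : ξ t ⬝ᵥ (E t *ᵥ (p.A m *ᵥ ξ t + p.sig m *ᵥ w t)) =
        ξ t ⬝ᵥ ((E t * (p.A m + p.S m * P)) *ᵥ ξ t) := by
      rw [hv, Matrix.mulVec_mulVec]
    rw [hw0] at hsq
    simp only [Matrix.add_mulVec, dotProduct_add, zero_dotProduct] at hsq ⊢
    simp only [Matrix.neg_mulVec, dotProduct_neg, Matrix.smul_mulVec, Matrix.one_mulVec,
      dotProduct_smul, smul_eq_mul] at hsq ⊢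
    have h5 : 0 ≤ u * (ξ t ⬝ᵥ ξ t) := by positivity
    nlinarith
  · intro i j
    have h2 : ∀ t : ℝ, HasDerivAt (fun t : ℝ => P i j + ((T - t) * p.ric m P i j -
        K * (1 : Matrix (Fin n) (Fin n) ℝ) i j * (T - t) ^ 2))
        (-p.ric m P i j + 2 * K * (T - t) * (1 : Matrix (Fin n) (Fin n) ℝ) i j) t := by
      intro t
      have := ((((hasDerivAt_id t).const_sub T).mul_const (p.ric m P i j)).sub
        (hasDerivAt_mul_sub_sq T (K * (1 : Matrix (Fin n) (Fin n) ℝ) i j) t)).const_add (P i j)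
      refine this.congr_deriv ?_
      ring
    convert HasACDeriv.of_hasDerivAt (T := T) h2 (by fun_prop) using 1
    · funext t
      simp only [hE, Matrix.add_apply, Matrix.sub_apply, Matrix.smul_apply, smul_eq_mul]
      ring
    · funext t
      simp only [Matrix.add_apply, Matrix.neg_apply, Matrix.smul_apply, smul_eq_mul]

/-- The first order expansion of the semigroups on quadratic functions, uniformly for bounded
matrices. The upper bound holds for all switching signals. -/
theorem CoreBounds.exists_one_step (h : p.CoreBounds cA β cD mD lam) {ρ : ℝ} (hρ : 0 ≤ ρ) :
    ∃ K T₀ : ℝ, 0 < K ∧ 0 < T₀ ∧ T₀ ≤ 1 ∧ ∀ P : Matrix (Fin n) (Fin n) ℝ, P.IsSymm → ‖P‖ ≤ ρ →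
      ∀ T : ℝ, 0 ≤ T → T ≤ T₀ →
      (∀ x w μ ξ, IsDisturbance w → Measurable μ → p.IsTrajectory x T w μ ξ →
        p.running T w μ ξ + quadForm P (ξ T) ≤ quadForm P x +
          ∑ m, occupation T μ m 0 * quadForm (p.ric m P) x + K * T ^ 2 * quadForm 1 x) ∧
      (∀ x m, ∃ w ξ, IsDisturbance w ∧ p.IsTrajectory x T w (fun _ => m) ξ ∧
        quadForm P x + T * quadForm (p.ric m P) x - K * T ^ 2 * quadForm 1 x ≤
          p.running T w (fun _ => m) ξ + quadForm P (ξ T)) := by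
  have bound : ∀ (B : Fin M → Matrix (Fin n) (Fin n) ℝ) m, ‖B m‖ ≤ ∑ m, ‖B m‖ := fun B m =>
    Finset.single_le_sum (f := fun m => ‖B m‖) (fun m _ => norm_nonneg _) (Finset.mem_univ m)
  have nn : ∀ B : Fin M → Matrix (Fin n) (Fin n) ℝ, 0 ≤ ∑ m, ‖B m‖ := fun B =>
    Finset.sum_nonneg fun m _ => norm_nonneg _
  have ha0 := nn p.A
  have hd0 := nn p.D
  have hs0 := nn p.S
  obtain ⟨a, ha⟩ : ∃ a, a = ∑ m, ‖p.A m‖ := ⟨_, rfl⟩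
  obtain ⟨d, hd⟩ : ∃ d, d = ∑ m, ‖p.D m‖ := ⟨_, rfl⟩
  obtain ⟨s, hs⟩ : ∃ s, s = ∑ m, ‖p.S m‖ := ⟨_, rfl⟩
  rw [← ha] at ha0
  rw [← hd] at hd0
  rw [← hs] at hs0
  -- `F` bounds all `ric_m(P)` and `L` is the resulting remainder constant. Taking `K = L + 1` makes
  -- it positive, and `T₀ = 1/K` gives `KT ≤ 1`, which keeps the quadratic correction below `T - t`
  -- in norm.
  obtain ⟨F, hF⟩ : ∃ F, F = a * ρ + ρ * a + ρ * s * ρ + d := ⟨_, rfl⟩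
  have hF0 : 0 ≤ F := by rw [hF]; positivity
  obtain ⟨L, hL⟩ : ∃ L, L = (2 * a + 2 * (ρ * s)) * (F + 1) + s * (F + 1) ^ 2 := ⟨_, rfl⟩
  have hL0 : 0 ≤ L := by rw [hL]; positivity
  have hK0 : 0 < L + 1 := by positivity
  have hT1 : 1 / (L + 1) ≤ 1 := (div_le_one hK0).2 (by linarith)
  refine ⟨L + 1, 1 / (L + 1), hK0, by positivity, hT1, ?_⟩
  intro P hP hPρ T hT hTT
  have hKT : (L + 1) * T ≤ 1 := by rwa [le_div_iff₀' hK0] at hTT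
  have hric : ∀ m, ‖p.ric m P‖ ≤ F := fun m =>
    hF ▸ norm_riccati_le (ha ▸ bound p.A m) (hd ▸ bound p.D m) (hs ▸ bound p.S m) hPρ
  exact ⟨fun x w μ ξ hw hμ hξ => h.one_step_le (ha ▸ bound p.A) (hs ▸ bound p.S) hs0 hF0
      hK0.le (by linarith) hT (hTT.trans hT1) hKT hP hPρ hric hw hμ hξ,
    fun x m => h.exists_le_one_step (ha ▸ bound p.A) (hs ▸ bound p.S) ha0 hs0 hF0
      hK0.le (by linarith) hT (hTT.trans hT1) hKT hP hPρ hric x m⟩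

end SwitchingLQ

namespace SwitchingLQ

variable {n k M : ℕ} {p : SwitchingLQ n k M} {cA β cD mD lam : ℝ}

/-! ### The Euler scheme -/

/-- One explicit Euler step for the Riccati equation of the index `m`. -/
noncomputable def euler (p : SwitchingLQ n k M) (τ : ℝ) (P : Matrix (Fin n) (Fin n) ℝ)
    (m : Fin M) : Matrix (Fin n) (Fin n) ℝ :=
  P + τ • p.ric m P

theorem quadForm_euler (τ : ℝ) (P : Matrix (Fin n) (Fin n) ℝ) (m : Fin M) (x : Fin n → ℝ) :
    quadForm (p.euler τ P m) x = quadForm P x + τ * quadForm (p.ric m P) x := by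
  rw [euler, quadForm_add, quadForm_smul]

theorem quadForm_one_nonneg (x : Fin n → ℝ) :
    0 ≤ quadForm (1 : Matrix (Fin n) (Fin n) ℝ) x := by
  rw [quadForm_one]
  exact mul_nonneg (by norm_num) (dotProduct_self_nonneg' x)

/-- For every trajectory of length `T` whose switching signal takes values in `U`, the payoff
with terminal payoff `f` is at most `g` of the initial state. -/
def Dominates (p : SwitchingLQ n k M) (U : Set (Fin M)) (T : ℝ) (f g : (Fin n → ℝ) → ℝ) : Prop :=
  ∀ (x : Fin n → ℝ) (w : ℝ → Fin k → ℝ) (μ : ℝ → Fin M) (ξ : ℝ → Fin n → ℝ),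
    IsDisturbance w → Measurable μ → (∀ t, μ t ∈ U) → p.IsTrajectory x T w μ ξ →
      p.running T w μ ξ + f (ξ T) ≤ g x

theorem CoreBounds.dominates_lam (h : p.CoreBounds cA β cD mD lam) {κ T : ℝ} (hκ : 0 ≤ κ)
    (hκ1 : κ ≤ 1) (hκπ : lam * κ * (1 + 2 * cA) + (-2 * cA * lam + β * lam ^ 2 + cD) ≤ 0)
    (hT : 0 ≤ T) (hT1 : T ≤ 1) (U : Set (Fin M)) :
    p.Dominates U T (quadForm (lam • 1)) (fun x => (1 - κ * T) * quadForm (lam • 1) x) := by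
  intro x w μ ξ hw hμ _ hξ
  refine h.payoff_le_lam hκ hT (by nlinarith) ?_ hw hμ hξ
  have h1 : 2 * cA * T ≤ 2 * cA := by nlinarith [h.cA_pos]
  have h2 := mul_le_mul_of_nonneg_left h1 (mul_nonneg h.lam_pos.le hκ)
  linarith

-- Up to second order the step is a congruence: `R + τ ric(R) = (I + τA)'R(I + τA) - τ²A'RA + τ(RΣR
-- + D)`. The second order terms are absorbed by `D ≥ mD I` for the lower bound, and by the strict
-- supersolution margin of `lam I` for the upper one.
open scoped Matrix.Norms.L2Operator in
theorem CoreBounds.symmBetween_euler (h : p.CoreBounds cA β cD mD lam) :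
    ∃ T₀ : ℝ, 0 < T₀ ∧ ∀ τ, 0 ≤ τ → τ ≤ T₀ → ∀ R, SymmBetween R lam → ∀ m,
      SymmBetween (p.euler τ R m) lam := by
  have hl := h.lam_pos
  set b := ∑ m, ‖(p.A m)ᵀ * p.A m‖ with hb
  have hb0 : 0 ≤ b := Finset.sum_nonneg fun m _ => norm_nonneg _
  have hA : ∀ m x, (p.A m *ᵥ x) ⬝ᵥ (p.A m *ᵥ x) ≤ b * (x ⬝ᵥ x) := by
    intro m x
    have h1 := (le_abs_self _).trans (dotProduct_mulVec_le_norm ((p.A m)ᵀ * p.A m) x)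
    rw [← Matrix.mulVec_mulVec, dotProduct_mulVec_transpose, Matrix.transpose_transpose] at h1
    refine h1.trans (mul_le_mul_of_nonneg_right ?_ (dotProduct_self_nonneg' x))
    exact Finset.single_le_sum (f := fun m => ‖(p.A m)ᵀ * p.A m‖) (fun m _ => norm_nonneg _)
      (Finset.mem_univ m)
  have hs := h.strict
  have hmD : 0 < mD := (by have := h.β_pos; positivity : 0 < β * lam ^ 2).trans h.lt_mD
  set d := -2 * cA * lam + β * lam ^ 2 + cD
  obtain ⟨r, hr0, hr⟩ : ∃ r, 0 < r ∧ r * (lam * b) ≤ min mD (-d) := by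
    refine ⟨min mD (-d) / (lam * b + 1), ?_, ?_⟩
    · have : 0 < min mD (-d) := lt_min hmD (by linarith)
      positivity
    · have : 0 < min mD (-d) := lt_min hmD (by linarith)
      rw [div_mul_eq_mul_div, div_le_iff₀ (by positivity)]
      nlinarith
  refine ⟨r, hr0, fun τ h0 h1 R hR m => ?_⟩
  have expand : ∀ x, x ⬝ᵥ (p.euler τ R m *ᵥ x) =
      (x + τ • (p.A m *ᵥ x)) ⬝ᵥ (R *ᵥ (x + τ • (p.A m *ᵥ x))) -
        τ ^ 2 * ((p.A m *ᵥ x) ⬝ᵥ (R *ᵥ (p.A m *ᵥ x))) +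
        τ * ((R *ᵥ x) ⬝ᵥ (p.S m *ᵥ (R *ᵥ x)) + x ⬝ᵥ (p.D m *ᵥ x)) := by
    intro x
    rw [euler, Matrix.add_mulVec, dotProduct_add, Matrix.smul_mulVec, dotProduct_smul, ric,
      dotProduct_riccati hR.symm, Matrix.mulVec_add, Matrix.mulVec_smul, dotProduct_add,
      add_dotProduct, add_dotProduct, dotProduct_smul, smul_dotProduct, smul_dotProduct,
      dotProduct_smul, hR.symm.dotProduct_mulVec_comm x (p.A m *ᵥ x),
      dotProduct_comm (p.A m *ᵥ x) (R *ᵥ x)]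
    simp only [smul_eq_mul]
    ring
  have hτb : τ * (lam * b) ≤ min mD (-d) :=
    (mul_le_mul_of_nonneg_right h1 (by positivity)).trans hr
  have hrem : ∀ x, τ ^ 2 * ((p.A m *ᵥ x) ⬝ᵥ (R *ᵥ (p.A m *ᵥ x))) ≤
      τ * (min mD (-d) * (x ⬝ᵥ x)) := by
    intro x
    calc τ ^ 2 * ((p.A m *ᵥ x) ⬝ᵥ (R *ᵥ (p.A m *ᵥ x)))
        ≤ τ ^ 2 * (lam * (b * (x ⬝ᵥ x))) := by
          gcongr
          exact (hR.le _).trans (by gcongr; exact hA m x)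
      _ = τ * (τ * (lam * b) * (x ⬝ᵥ x)) := by ring
      _ ≤ _ := by
          gcongr
          exact dotProduct_self_nonneg' x
  refine ⟨hR.symm.add ((h.isSymm_ric hR.symm m).smul _), fun x => ?_, fun x => ?_⟩
  · rw [expand]
    have e1 := hR.nonneg (x + τ • (p.A m *ᵥ x))
    have e2 := mul_nonneg h0 (h.S_nonneg m (R *ᵥ x))
    have e3 := mul_le_mul_of_nonneg_left (h.le_D m x) h0
    have e4 := mul_le_mul_of_nonneg_left (mul_le_mul_of_nonneg_right (min_le_left mD (-d))
      (dotProduct_self_nonneg' x)) h0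
    linarith [hrem x]
  · have e0 : 0 ≤ τ ^ 2 * ((p.A m *ᵥ x) ⬝ᵥ (R *ᵥ (p.A m *ᵥ x))) :=
      mul_nonneg (sq_nonneg _) (hR.nonneg _)
    have e1 := hR.le (x + τ • (p.A m *ᵥ x))
    have e2 : (x + τ • (p.A m *ᵥ x)) ⬝ᵥ (x + τ • (p.A m *ᵥ x)) =
        x ⬝ᵥ x + 2 * τ * (x ⬝ᵥ (p.A m *ᵥ x)) + τ ^ 2 * ((p.A m *ᵥ x) ⬝ᵥ (p.A m *ᵥ x)) := by
      rw [dotProduct_add, add_dotProduct, add_dotProduct, dotProduct_smul, smul_dotProduct,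
        smul_dotProduct, dotProduct_smul, dotProduct_comm (p.A m *ᵥ x) x]
      simp only [smul_eq_mul]
      ring
    have e3 := mul_le_mul_of_nonneg_left (h.stable m x) (by positivity : 0 ≤ 2 * τ * lam)
    have e4 : lam * (τ ^ 2 * ((p.A m *ᵥ x) ⬝ᵥ (p.A m *ᵥ x))) ≤ τ * (-d * (x ⬝ᵥ x)) := by
      calc lam * (τ ^ 2 * ((p.A m *ᵥ x) ⬝ᵥ (p.A m *ᵥ x)))
          ≤ lam * (τ ^ 2 * (b * (x ⬝ᵥ x))) := by gcongr; exact hA m x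
        _ = τ * (τ * (lam * b) * (x ⬝ᵥ x)) := by ring
        _ ≤ _ := by
          gcongr
          · exact dotProduct_self_nonneg' x
          · exact hτb.trans (min_le_right _ _)
    have e5 : (R *ᵥ x) ⬝ᵥ (p.S m *ᵥ (R *ᵥ x)) ≤ β * (lam ^ 2 * (x ⬝ᵥ x)) :=
      (h.S_le m _).trans (mul_le_mul_of_nonneg_left (hR.mulVec_sq_le hl x) h.β_pos.le)
    have e6 := mul_le_mul_of_nonneg_left (add_le_add e5 (h.D_le m x)) h0
    rw [expand]
    rw [e2] at e1
    have e7 : τ * (-d * (x ⬝ᵥ x)) = -(τ * (β * (lam ^ 2 * (x ⬝ᵥ x)) + cD * (x ⬝ᵥ x))) +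
      2 * τ * lam * (cA * (x ⬝ᵥ x)) := by
      simp only [d]; ring
    linarith

/-- The linear terms of the Riccati operator scale with `c`, while the constant and the quadratic
term do not. For `c` near `1` the discrepancy has the sign of `1 - c` as soon as `D - RΣR` is
positive definite; this is the slack that absorbs the local error. -/
theorem quadForm_ric_smul {R : Matrix (Fin n) (Fin n) ℝ} (hR : R.IsSymm) (c : ℝ) (m : Fin M)
    (x : Fin n → ℝ) :
    quadForm (p.ric m (c • R)) x = c * quadForm (p.ric m R) x +
      (1 / 2) * ((1 - c) * (x ⬝ᵥ (p.D m *ᵥ x) - c * ((R *ᵥ x) ⬝ᵥ (p.S m *ᵥ (R *ᵥ x))))) := by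
  rw [quadForm, quadForm, ric, ric, dotProduct_riccati (hR.smul c), dotProduct_riccati hR]
  simp only [Matrix.smul_mulVec, Matrix.mulVec_smul, smul_dotProduct, dotProduct_smul,
    smul_eq_mul]
  ring

open scoped Matrix.Norms.L2Operator in
/-- For a suitable `c`, the Euler scheme multiplied by `1 + cτ` dominates the semigroups, and
multiplied by `1 - cτ` it is dominated by them. -/
theorem CoreBounds.exists_euler_bounds (h : p.CoreBounds cA β cD mD lam) :
    ∃ c T₀ : ℝ, 0 < c ∧ 0 < T₀ ∧ T₀ ≤ 1 ∧ c * T₀ ≤ 1 ∧ ∀ τ, 0 < τ → τ ≤ T₀ →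
      ∀ R, SymmBetween R lam →
      (∀ m, SymmBetween (p.euler τ R m) lam) ∧
      (∀ x w μ ξ, IsDisturbance w → Measurable μ → p.IsTrajectory x τ w μ ξ → ∀ b : ℝ,
        (∀ t, (1 + c * τ) * quadForm (p.euler τ R (μ t)) x ≤ b) →
          p.running τ w μ ξ + (1 + c * τ) * quadForm R (ξ τ) ≤ b) ∧
      (∀ x m, ∃ w ξ, IsDisturbance w ∧ p.IsTrajectory x τ w (fun _ => m) ξ ∧
        (1 - c * τ) * quadForm (p.euler τ R m) x ≤
          p.running τ w (fun _ => m) ξ + (1 - c * τ) * quadForm R (ξ τ)) := by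
  have hl := h.lam_pos
  have hβ := h.β_pos
  obtain ⟨T₁, hT₁, hinv⟩ := h.symmBetween_euler
  obtain ⟨K, T₂, hK, hT₂, hT₂1, hstep⟩ := h.exists_one_step (ρ := 2 * lam) (by positivity)
  -- `α` is half of the positivity margin of `D - RΣR`, the other half being spent on the factor `1
  -- + cτ`. With `c = K/α`, the slack `cτ · α` over a time `τ` is exactly the local error `Kτ²`.
  obtain ⟨α, hα⟩ : ∃ α, α = (mD - β * lam ^ 2) / 2 := ⟨_, rfl⟩
  have hα0 : 0 < α := by rw [hα]; linarith [h.lt_mD]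
  have hc : 0 < K / α := by positivity
  set c := K / α with hcdef
  have hcα : c * α = K := by rw [hcdef]; field_simp
  -- The two bounds give `cτ ≤ 1` and `cτ β lam² ≤ α`, so that `D - rRΣR ≥ α I` for all `0 ≤ r ≤ 1 +
  -- cτ`.
  set T₃ := min (1 / c) (α / (c * (β * lam ^ 2))) with hT₃
  have hT₃0 : 0 < T₃ := by positivity
  refine ⟨c, min T₁ (min T₂ T₃), hc, by positivity, (min_le_right _ _).trans
    ((min_le_left _ _).trans hT₂1), ?_, ?_⟩
  · calc c * min T₁ (min T₂ T₃) ≤ c * (1 / c) := by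
          gcongr
          exact (min_le_right _ _).trans ((min_le_right _ _).trans (min_le_left _ _))
      _ = 1 := by field_simp
  intro τ hτ hτT R hR
  have hτ1 : τ ≤ T₁ := hτT.trans (min_le_left _ _)
  have hτ2 : τ ≤ T₂ := hτT.trans ((min_le_right _ _).trans (min_le_left _ _))
  have hτ3 : τ ≤ T₃ := hτT.trans ((min_le_right _ _).trans (min_le_right _ _))
  obtain ⟨a, ha⟩ : ∃ a, a = c * τ := ⟨_, rfl⟩
  have ha0 : 0 < a := by rw [ha]; positivity
  have ha1 : a ≤ 1 := by
    have := hτ3.trans (min_le_left _ _)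
    rwa [le_div_iff₀' hc, ← ha] at this
  have ha2 : a * (β * lam ^ 2) ≤ α := by
    have := hτ3.trans (min_le_right _ _)
    rw [le_div_iff₀' (by positivity)] at this
    rw [ha]; linarith
  have haα : a * α = K * τ := by rw [ha, ← hcα]; ring
  have hnorm : ∀ r : ℝ, 0 ≤ r → r ≤ 2 → ‖r • R‖ ≤ 2 * lam := by
    intro r h0 h1
    rw [norm_smul, Real.norm_of_nonneg h0]
    exact mul_le_mul h1 (hR.norm_le hl) (norm_nonneg _) (by norm_num)
  have hRS : ∀ m x, (R *ᵥ x) ⬝ᵥ (p.S m *ᵥ (R *ᵥ x)) ≤ β * lam ^ 2 * (x ⬝ᵥ x) := fun m x =>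
    (h.S_le m _).trans (by
      rw [mul_assoc]; exact mul_le_mul_of_nonneg_left (hR.mulVec_sq_le hl x) h.β_pos.le)
  have gap : ∀ r, 0 ≤ r → r ≤ 1 + a → ∀ m x,
      α * (x ⬝ᵥ x) ≤ x ⬝ᵥ (p.D m *ᵥ x) - r * ((R *ᵥ x) ⬝ᵥ (p.S m *ᵥ (R *ᵥ x))) := by
    intro r h0 h1 m x
    have e1 := h.le_D m x
    have e2 : r * ((R *ᵥ x) ⬝ᵥ (p.S m *ᵥ (R *ᵥ x))) ≤ (1 + a) * (β * lam ^ 2 * (x ⬝ᵥ x)) :=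
      mul_le_mul h1 (hRS m x) (h.S_nonneg m _) (by linarith)
    have e3 := mul_le_mul_of_nonneg_right ha2 (dotProduct_self_nonneg' x)
    have e4 : mD = 2 * α + β * lam ^ 2 := by rw [hα]; ring
    rw [e4] at e1
    linarith
  rw [← ha]
  refine ⟨hinv τ hτ.le hτ1 R hR, ?_, ?_⟩
  · intro x w μ ξ hw hμ hξ b hb
    have key := (hstep ((1 + a) • R) (hR.symm.smul _) (hnorm _ (by linarith) (by linarith))
      τ hτ.le hτ2).1 x w μ ξ hw hμ hξ
    rw [quadForm_smul, quadForm_smul] at key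
    have hocc : ∀ m, occupation τ μ m 0 * quadForm (p.ric m ((1 + a) • R)) x ≤
        occupation τ μ m 0 * ((b - (1 + a) * quadForm R x) / τ - a * α * quadForm 1 x) := by
      intro m
      -- The bound `b` is known only for indices that `μ` takes; the others have occupation time
      -- zero.
      by_cases hm : ∃ t, μ t = m
      · obtain ⟨t, rfl⟩ := hm
        refine mul_le_mul_of_nonneg_left ?_ (occupation_nonneg hτ.le _)
        have e1 := hb t
        rw [quadForm_euler] at e1
        have e2 : (1 + a) * quadForm (p.ric (μ t) R) x ≤ (b - (1 + a) * quadForm R x) / τ := by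
          rw [le_div_iff₀ hτ]; linarith
        have e3 := mul_le_mul_of_nonneg_left (gap (1 + a) (by linarith) le_rfl (μ t) x) ha0.le
        rw [quadForm_ric_smul hR.symm, quadForm_one]
        linarith
      · have : occupation τ μ m 0 = 0 := by
          simp [occupation, fun t => (not_exists.1 hm t)]
        simp [this]
    have hsum := Finset.sum_le_sum fun m (_ : m ∈ Finset.univ) => hocc m
    rw [← Finset.sum_mul, sum_occupation hμ, sub_zero, mul_sub, mul_div_cancel₀ _ hτ.ne'] at hsum
    have e5 : τ * (a * α * quadForm 1 x) = K * τ ^ 2 * quadForm 1 x := by rw [haα]; ring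
    linarith
  · intro x m
    obtain ⟨w, ξ, hw, hξ, key⟩ := (hstep ((1 - a) • R) (hR.symm.smul _)
      (hnorm _ (by linarith) (by linarith)) τ hτ.le hτ2).2 x m
    refine ⟨w, ξ, hw, hξ, ?_⟩
    rw [quadForm_smul, quadForm_smul, quadForm_ric_smul hR.symm] at key
    rw [quadForm_euler]
    have e3 := mul_le_mul_of_nonneg_left (gap (1 - a) (by linarith) (by linarith) m x)
      (by positivity : 0 ≤ τ * a)
    have e5 : τ * a * (α * (x ⬝ᵥ x)) = 2 * (K * τ ^ 2 * quadForm 1 x) := by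
      rw [quadForm_one, show τ * a * (α * (x ⬝ᵥ x)) = τ * (a * α) * (x ⬝ᵥ x) by ring, haα]; ring
    linarith

/-- The Euler scheme along a word. -/
noncomputable def eulerWord (p : SwitchingLQ n k M) (τ : ℝ) (P : Matrix (Fin n) (Fin n) ℝ)
    {N : ℕ} (i : Fin N → Fin M) : Matrix (Fin n) (Fin n) ℝ :=
  (List.ofFn i).foldl (p.euler τ) P

theorem eulerWord_zero (τ : ℝ) (P : Matrix (Fin n) (Fin n) ℝ) (i : Fin 0 → Fin M) :
    p.eulerWord τ P i = P := by simp [eulerWord]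

theorem eulerWord_succ (τ : ℝ) (P : Matrix (Fin n) (Fin n) ℝ) {N : ℕ} (i : Fin (N + 1) → Fin M) :
    p.eulerWord τ P i = p.euler τ (p.eulerWord τ P fun j => i j.castSucc) (i (Fin.last N)) := by
  rw [eulerWord, List.ofFn_succ', List.concat_eq_append, List.foldl_append]
  rfl

end SwitchingLQ

namespace SwitchingLQ

variable {n k M : ℕ} {p : SwitchingLQ n k M} {cA β cD mD lam : ℝ}

/-! ### Concatenation and splitting of trajectories -/

/-- `w` is measurable and square integrable on `(a, b]`. -/
def IsSquareIntegrableOn (w : ℝ → Fin k → ℝ) (a b : ℝ) : Prop :=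
  AEStronglyMeasurable w (volume.restrict (Set.Ioc a b)) ∧
    IntegrableOn (fun t => w t ⬝ᵥ w t) (Set.Ioc a b)

/-- Endpoints are null sets; half-open intervals are used because they concatenate without overlap.
-/
theorem isDisturbance_iff {w : ℝ → Fin k → ℝ} :
    IsDisturbance w ↔ ∀ T, IsSquareIntegrableOn w 0 T := by
  simp only [IsDisturbance, IsSquareIntegrableOn, IntegrableOn, restrict_Ioc_eq_restrict_Icc]

namespace IsSquareIntegrableOn

variable {w w' : ℝ → Fin k → ℝ} {a b c : ℝ}

theorem mono (h : IsSquareIntegrableOn w a b) {a' b' : ℝ} (ha : a ≤ a') (hb : b' ≤ b) :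
    IsSquareIntegrableOn w a' b' :=
  ⟨h.1.mono_measure (Measure.restrict_mono (Set.Ioc_subset_Ioc ha hb) le_rfl),
    h.2.mono_set (Set.Ioc_subset_Ioc ha hb)⟩

theorem congr (h : IsSquareIntegrableOn w a b) (hw : ∀ t ∈ Set.Ioc a b, w t = w' t) :
    IsSquareIntegrableOn w' a b :=
  ⟨h.1.congr ((ae_restrict_iff' measurableSet_Ioc).2 (.of_forall hw)),
    h.2.congr_fun (fun t ht => by simp only [hw t ht]) measurableSet_Ioc⟩

theorem union (h : IsSquareIntegrableOn w a b) (h' : IsSquareIntegrableOn w b c) (hab : a ≤ b)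
    (hbc : b ≤ c) : IsSquareIntegrableOn w a c := by
  rw [IsSquareIntegrableOn, ← Set.Ioc_union_Ioc_eq_Ioc hab hbc]
  exact ⟨aestronglyMeasurable_union_iff.2 ⟨h.1, h'.1⟩, h.2.union h'.2⟩

theorem comp_add_right (h : IsSquareIntegrableOn w (a + c) (b + c)) :
    IsSquareIntegrableOn (fun t => w (t + c)) a b := by
  have hp := (measurePreserving_add_right volume c).restrict_preimage
    (measurableSet_Ioc (a := a + c) (b := b + c))
  simp only [Set.preimage_add_const_Ioc, add_sub_cancel_right] at hp
  exact ⟨h.1.comp_measurePreserving hp, (hp.integrable_comp h.2.aestronglyMeasurable).2 h.2⟩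

end IsSquareIntegrableOn

theorem IsDisturbance.shift {w : ℝ → Fin k → ℝ} (hw : IsDisturbance w) {τ : ℝ} (hτ : 0 ≤ τ) :
    IsDisturbance fun t => w (t + τ) := by
  rw [isDisturbance_iff] at hw ⊢
  exact fun T => ((hw (T + τ)).mono (by simpa using hτ) le_rfl).comp_add_right

/-- `f` up to time `T` and `g`, started at time `T`, afterwards. -/
noncomputable def concatAt {α : Type*} (T : ℝ) (f g : ℝ → α) (t : ℝ) : α :=
  if t ≤ T then f t else g (t - T)

theorem concatAt_of_le {α : Type*} {T : ℝ} {f g : ℝ → α} {t : ℝ} (ht : t ≤ T) :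
    concatAt T f g t = f t := if_pos ht

theorem concatAt_of_lt {α : Type*} {T : ℝ} {f g : ℝ → α} {t : ℝ} (ht : T < t) :
    concatAt T f g t = g (t - T) := if_neg ht.not_ge

theorem IsDisturbance.concat {w w' : ℝ → Fin k → ℝ} (hw : IsDisturbance w)
    (hw' : IsDisturbance w') {T : ℝ} (hT : 0 ≤ T) : IsDisturbance (concatAt T w w') := by
  rw [isDisturbance_iff] at hw hw' ⊢
  intro T'
  rcases le_total T' T with h | h
  · exact (hw T').congr fun t ht => (concatAt_of_le (ht.2.trans h)).symm
  · refine ((hw T).congr fun t ht => (concatAt_of_le ht.2).symm).union ?_ hT h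
    have : IsSquareIntegrableOn (fun t => w' (t + -T)) T T' := by
      refine IsSquareIntegrableOn.comp_add_right ((hw' (T' + -T)).mono ?_ le_rfl)
      simp
    exact this.congr fun t ht => (concatAt_of_lt ht.1).symm

theorem measurable_concatAt {μ μ' : ℝ → Fin M} (hμ : Measurable μ) (hμ' : Measurable μ') (T : ℝ) :
    Measurable (concatAt T μ μ') :=
  Measurable.ite measurableSet_Iic hμ (hμ'.comp (measurable_id.sub_const T))

theorem concatAt_integral_left {F F₁ : ℝ → ℝ} {T t : ℝ} (h0 : 0 ≤ t) (htT : t ≤ T)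
    (hF : ∀ s, s ≤ T → F s = F₁ s) : ∫ s in (0 : ℝ)..t, F s = ∫ s in (0 : ℝ)..t, F₁ s :=
  intervalIntegral.integral_congr fun s hs => by
    rw [Set.uIcc_of_le h0] at hs
    exact hF s (hs.2.trans htT)

theorem concatAt_integral_right {F F₂ : ℝ → ℝ} {T t : ℝ} (h0 : 0 ≤ t)
    (hF : ∀ s, T < s → F s = F₂ (s - T)) :
    ∫ s in T..(T + t), F s = ∫ s in (0 : ℝ)..t, F₂ s := by
  have : ∫ s in T..(T + t), F s = ∫ s in T..(T + t), F₂ (s - T) :=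
    intervalIntegral.integral_congr_ae (.of_forall fun s hs => by
      rw [Set.uIoc_of_le (by linarith)] at hs
      exact hF s hs.1)
  rw [this, intervalIntegral.integral_comp_sub_right]
  simp

theorem IsTrajectory.concat {x : Fin n → ℝ} {T₁ T₂ : ℝ} (h1 : 0 ≤ T₁) (h2 : 0 ≤ T₂)
    {w₁ w₂ : ℝ → Fin k → ℝ} (hw₁ : IsDisturbance w₁) (hw₂ : IsDisturbance w₂)
    {μ₁ μ₂ : ℝ → Fin M} (hμ₁ : Measurable μ₁) (hμ₂ : Measurable μ₂) {ξ₁ ξ₂ : ℝ → Fin n → ℝ}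
    (hξ₁ : p.IsTrajectory x T₁ w₁ μ₁ ξ₁) (hξ₂ : p.IsTrajectory (ξ₁ T₁) T₂ w₂ μ₂ ξ₂) :
    p.IsTrajectory x (T₁ + T₂) (concatAt T₁ w₁ w₂) (concatAt T₁ μ₁ μ₂) (concatAt T₁ ξ₁ ξ₂) ∧
    p.running (T₁ + T₂) (concatAt T₁ w₁ w₂) (concatAt T₁ μ₁ μ₂) (concatAt T₁ ξ₁ ξ₂) =
      p.running T₁ w₁ μ₁ ξ₁ + p.running T₂ w₂ μ₂ ξ₂ := by
  have hw := hw₁.concat hw₂ h1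
  have hμ := measurable_concatAt hμ₁ hμ₂ T₁
  have hc : ContinuousOn (concatAt T₁ ξ₁ ξ₂) (Set.Icc 0 (T₁ + T₂)) := by
    rw [← Set.Icc_union_Icc_eq_Icc h1 (by linarith : T₁ ≤ T₁ + T₂)]
    refine ContinuousOn.union_of_isClosed ?_ ?_ isClosed_Icc isClosed_Icc
    · exact hξ₁.1.congr fun t ht => concatAt_of_le ht.2
    · have : ContinuousOn (fun t => ξ₂ (t - T₁)) (Set.Icc T₁ (T₁ + T₂)) :=
        hξ₂.1.comp (by fun_prop) fun t ht => ⟨by linarith [ht.1], by linarith [ht.2]⟩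
      refine this.congr fun t ht => ?_
      -- At the junction `concatAt` takes the value of the first piece, which is the initial state
      -- of the second.
      rcases ht.1.eq_or_lt with rfl | hlt
      · simp only [concatAt_of_le le_rfl, sub_self, hξ₂.initial h2]
      · exact concatAt_of_lt hlt
  have e1 : ∀ s, s ≤ T₁ → concatAt T₁ w₁ w₂ s = w₁ s ∧ concatAt T₁ μ₁ μ₂ s = μ₁ s ∧
      concatAt T₁ ξ₁ ξ₂ s = ξ₁ s := fun s hs =>
    ⟨concatAt_of_le hs, concatAt_of_le hs, concatAt_of_le hs⟩
  have e2 : ∀ s, T₁ < s → concatAt T₁ w₁ w₂ s = w₂ (s - T₁) ∧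
      concatAt T₁ μ₁ μ₂ s = μ₂ (s - T₁) ∧ concatAt T₁ ξ₁ ξ₂ s = ξ₂ (s - T₁) := fun s hs =>
    ⟨concatAt_of_lt hs, concatAt_of_lt hs, concatAt_of_lt hs⟩
  constructor
  · refine isTrajectory_of_apply hw hμ hc fun t ht i => ?_
    have hl : ∀ r, 0 ≤ r → r ≤ T₁ → ∫ s in (0 : ℝ)..r,
        (p.A (concatAt T₁ μ₁ μ₂ s) *ᵥ concatAt T₁ ξ₁ ξ₂ s +
          p.sig (concatAt T₁ μ₁ μ₂ s) *ᵥ concatAt T₁ w₁ w₂ s) i =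
        ∫ s in (0 : ℝ)..r, (p.A (μ₁ s) *ᵥ ξ₁ s + p.sig (μ₁ s) *ᵥ w₁ s) i := fun r h0 hr =>
      concatAt_integral_left h0 hr fun s hs => by
        obtain ⟨a, b, c⟩ := e1 s hs
        rw [a, b, c]
    rcases le_or_gt t T₁ with h | h
    · rw [hl t ht.1 h, (e1 t h).2.2]
      exact hξ₁.apply_eq hw₁ hμ₁ ⟨ht.1, h⟩ i
    · have hi := p.intervalIntegrable_drift ht.1 hw hμ
        (hc.mono (Set.Icc_subset_Icc_right ht.2)) i
      have hm : T₁ ∈ Set.uIcc 0 t := by rw [Set.uIcc_of_le ht.1]; exact ⟨h1, h.le⟩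
      have hr : T₁ + (t - T₁) = t := by ring
      rw [← intervalIntegral.integral_add_adjacent_intervals
        (hi.mono_set (Set.uIcc_subset_uIcc Set.left_mem_uIcc hm))
        (hi.mono_set (Set.uIcc_subset_uIcc hm Set.right_mem_uIcc)), hl T₁ h1 le_rfl,
        ← add_assoc, ← hξ₁.apply_eq hw₁ hμ₁ ⟨h1, le_rfl⟩ i, (e2 t h).2.2]
      conv_rhs => rw [← hr]
      rw [concatAt_integral_right (F₂ := fun s => (p.A (μ₂ s) *ᵥ ξ₂ s + p.sig (μ₂ s) *ᵥ w₂ s) i)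
        (by linarith) fun s hs => by
          obtain ⟨a, b, c⟩ := e2 s hs
          rw [a, b, c]]
      exact hξ₂.apply_eq hw₂ hμ₂ ⟨by linarith, by linarith [ht.2]⟩ i
  · have hi := p.intervalIntegrable_payoff (by linarith : 0 ≤ T₁ + T₂) hw hμ hc
    have hm : T₁ ∈ Set.uIcc 0 (T₁ + T₂) := by
      rw [Set.uIcc_of_le (by linarith)]; exact ⟨h1, by linarith⟩
    rw [running, ← intervalIntegral.integral_add_adjacent_intervals
        (hi.mono_set (Set.uIcc_subset_uIcc Set.left_mem_uIcc hm))
        (hi.mono_set (Set.uIcc_subset_uIcc hm Set.right_mem_uIcc)), running, running]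
    congr 1
    · exact concatAt_integral_left h1 le_rfl fun s hs => by
        obtain ⟨a, b, c⟩ := e1 s hs
        rw [a, b, c]
    · exact concatAt_integral_right (F₂ := fun t => (1 / 2) * (ξ₂ t ⬝ᵥ (p.D (μ₂ t) *ᵥ ξ₂ t)) -
        p.γ ^ 2 / 2 * (w₂ t ⬝ᵥ w₂ t)) h2 fun s hs => by
        obtain ⟨a, b, c⟩ := e2 s hs
        rw [a, b, c]

theorem IsTrajectory.split {x : Fin n → ℝ} {τ T : ℝ} (h0 : 0 ≤ τ) (hT : τ ≤ T)
    {w : ℝ → Fin k → ℝ} (hw : IsDisturbance w) {μ : ℝ → Fin M} (hμ : Measurable μ)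
    {ξ : ℝ → Fin n → ℝ} (hξ : p.IsTrajectory x T w μ ξ) :
    p.IsTrajectory x τ w μ ξ ∧
    p.IsTrajectory (ξ τ) (T - τ) (fun t => w (t + τ)) (fun t => μ (t + τ)) (fun t => ξ (t + τ)) ∧
    p.running T w μ ξ = p.running τ w μ ξ +
      p.running (T - τ) (fun t => w (t + τ)) (fun t => μ (t + τ)) (fun t => ξ (t + τ)) := by
  have h0T := h0.trans hT
  refine ⟨⟨hξ.1.mono (Set.Icc_subset_Icc_right hT),
    fun t ht => hξ.2 t ⟨ht.1, ht.2.trans hT⟩⟩, ?_, ?_⟩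
  · have hμ' : Measurable fun t => μ (t + τ) := hμ.comp (measurable_add_const τ)
    refine isTrajectory_of_apply (hw.shift h0) hμ'
      (hξ.1.comp (by fun_prop) fun t ht => ⟨by linarith [ht.1], by linarith [ht.2]⟩) ?_
    intro t ht i
    have htT : t + τ ≤ T := by linarith [ht.2]
    have ht0 : 0 ≤ t + τ := by linarith [ht.1]
    have hi := p.intervalIntegrable_drift ht0 hw hμ (hξ.1.mono (Set.Icc_subset_Icc_right htT)) i
    have hm : τ ∈ Set.uIcc 0 (t + τ) := by
      rw [Set.uIcc_of_le ht0]; exact ⟨h0, by linarith [ht.1]⟩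
    rw [hξ.apply_eq hw hμ ⟨ht0, htT⟩ i, hξ.apply_eq hw hμ ⟨h0, hT⟩ i,
      ← intervalIntegral.integral_add_adjacent_intervals
        (hi.mono_set (Set.uIcc_subset_uIcc Set.left_mem_uIcc hm))
        (hi.mono_set (Set.uIcc_subset_uIcc hm Set.right_mem_uIcc)),
      intervalIntegral.integral_comp_add_right
        (fun s => (p.A (μ s) *ᵥ ξ s + p.sig (μ s) *ᵥ w s) i) τ, zero_add]
    ring
  · have hi := p.intervalIntegrable_payoff h0T hw hμ hξ.1
    have hm : τ ∈ Set.uIcc 0 T := by rw [Set.uIcc_of_le h0T]; exact ⟨h0, hT⟩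
    rw [running, ← intervalIntegral.integral_add_adjacent_intervals
        (hi.mono_set (Set.uIcc_subset_uIcc Set.left_mem_uIcc hm))
        (hi.mono_set (Set.uIcc_subset_uIcc hm Set.right_mem_uIcc)), running, running,
      intervalIntegral.integral_comp_add_right
        (fun t => (1 / 2) * (ξ t ⬝ᵥ (p.D (μ t) *ᵥ ξ t)) - p.γ ^ 2 / 2 * (w t ⬝ᵥ w t)) τ,
      zero_add, sub_add_cancel]

/-! ### The value function -/

theorem CoreBounds.mD_pos (h : p.CoreBounds cA β cD mD lam) : 0 < mD :=
  (by have := h.β_pos; have := h.lam_pos; positivity : 0 < β * lam ^ 2).trans h.lt_mD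

/-- Without disturbance the running payoff is nonnegative because `D` is. This gives `V ≥ 0` and
allows any trajectory to be prolonged at no loss. -/
theorem CoreBounds.exists_undisturbed (h : p.CoreBounds cA β cD mD lam) (m : Fin M)
    (x : Fin n → ℝ) : ∃ w ξ, IsDisturbance w ∧ ∀ T, 0 ≤ T →
      p.IsTrajectory x T w (fun _ => m) ξ ∧ 0 ≤ p.running T w (fun _ => m) ξ := by
  obtain ⟨ξ, hc, hξ⟩ := p.exists_feedback m 0 x
  refine ⟨_, ξ, isDisturbance_of_continuous (continuous_const.matrix_mulVec hc), fun T hT =>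
    ⟨hξ T, intervalIntegral.integral_nonneg hT fun t _ => ?_⟩⟩
  have e1 := h.le_D m (ξ t)
  have e2 := mul_nonneg h.mD_pos.le (dotProduct_self_nonneg' (ξ t))
  simp only [Matrix.zero_mulVec, zero_dotProduct, mul_zero, sub_zero]
  linarith

theorem CoreBounds.quadForm_lam_nonneg (h : p.CoreBounds cA β cD mD lam) (x : Fin n → ℝ) :
    0 ≤ quadForm (lam • (1 : Matrix (Fin n) (Fin n) ℝ)) x := by
  rw [quadForm_smul]
  exact mul_nonneg h.lam_pos.le (quadForm_one_nonneg x)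

theorem CoreBounds.running_le (h : p.CoreBounds cA β cD mD lam) {x : Fin n → ℝ} {T : ℝ}
    (hT : 0 ≤ T) {w : ℝ → Fin k → ℝ} (hw : IsDisturbance w) {μ : ℝ → Fin M} (hμ : Measurable μ)
    {ξ : ℝ → Fin n → ℝ} (hξ : p.IsTrajectory x T w μ ξ) :
    p.running T w μ ξ ≤ quadForm (lam • 1) x := by
  have h1 := h.payoff_le_lam le_rfl hT (by simp) (by simpa using h.strict.le) hw hμ hξ
  have h2 := h.quadForm_lam_nonneg (ξ T)
  rw [zero_mul, sub_zero, one_mul] at h1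
  linarith

theorem running_le_value {x : Fin n → ℝ} {T : ℝ} (hT : 0 < T) {w : ℝ → Fin k → ℝ}
    (hw : IsDisturbance w) {μ : ℝ → Fin M} (hμ : Measurable μ) {ξ : ℝ → Fin n → ℝ}
    (hξ : p.IsTrajectory x T w μ ξ) : (p.running T w μ ξ : EReal) ≤ p.value x :=
  le_iSup_of_le w <| le_iSup_of_le hw <| le_iSup_of_le μ <| le_iSup_of_le hμ <|
    le_iSup_of_le T <| le_iSup_of_le hT <| le_iSup_of_le ξ <| le_iSup_of_le hξ le_rfl

theorem value_le {x : Fin n → ℝ} {b : EReal} (h : ∀ (w : ℝ → Fin k → ℝ) (μ : ℝ → Fin M) (T : ℝ)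
    (ξ : ℝ → Fin n → ℝ), IsDisturbance w → Measurable μ → 0 < T → p.IsTrajectory x T w μ ξ →
      (p.running T w μ ξ : EReal) ≤ b) : p.value x ≤ b :=
  iSup_le fun w => iSup_le fun hw => iSup_le fun μ => iSup_le fun hμ => iSup_le fun T =>
    iSup_le fun hT => iSup_le fun ξ => iSup_le fun hξ => h w μ T ξ hw hμ hT hξ

/-- The value function is finite, nonnegative, at most `½ lam |x|²`, and satisfies the dynamic
programming principle. -/
theorem CoreBounds.exists_value (h : p.CoreBounds cA β cD mD lam) (hM : 0 < M) :
    ∃ V : (Fin n → ℝ) → ℝ, (∀ x, p.value x = (V x : EReal)) ∧ (∀ x, 0 ≤ V x) ∧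
      (∀ x, V x ≤ quadForm (lam • 1) x) ∧
      (∀ τ, 0 ≤ τ → p.Dominates Set.univ τ V V) ∧
      (∀ τ, 0 < τ → ∀ g, p.Dominates Set.univ τ V g → ∀ x, V x ≤ g x) := by
  let m₀ : Fin M := ⟨0, hM⟩
  have hle : ∀ x, p.value x ≤ (quadForm (lam • 1) x : EReal) := fun x =>
    value_le fun w μ T ξ hw hμ hT hξ => EReal.coe_le_coe_iff.2 (h.running_le hT.le hw hμ hξ)
  have hge : ∀ x, (0 : EReal) ≤ p.value x := by
    intro x
    obtain ⟨w, ξ, hw, hξ⟩ := h.exists_undisturbed m₀ x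
    obtain ⟨h1, h2⟩ := hξ 1 zero_le_one
    exact (EReal.coe_nonneg.2 h2).trans (running_le_value one_pos hw measurable_const h1)
  have hV : ∀ x, p.value x = ((p.value x).toReal : EReal) := fun x =>
    (EReal.coe_toReal (ne_top_of_le_ne_top (EReal.coe_ne_top _) (hle x))
      (ne_bot_of_le_ne_bot EReal.zero_ne_bot (hge x))).symm
  set V : (Fin n → ℝ) → ℝ := fun x => (p.value x).toReal with hVd
  have hV' : ∀ x, p.value x = (V x : EReal) := hV
  have run : ∀ {x T w μ ξ}, 0 < T → IsDisturbance w → Measurable μ → p.IsTrajectory x T w μ ξ →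
      p.running T w μ ξ ≤ V x := by
    intro x T w μ ξ hT hw hμ hξ
    have := running_le_value hT hw hμ hξ
    rwa [hV', EReal.coe_le_coe_iff] at this
  have leV : ∀ {x b}, (∀ (w : ℝ → Fin k → ℝ) (μ : ℝ → Fin M) (T : ℝ)
      (ξ : ℝ → Fin n → ℝ), IsDisturbance w → Measurable μ → 0 < T → p.IsTrajectory x T w μ ξ →
      p.running T w μ ξ ≤ b) → V x ≤ b := by
    intro x b hb
    rw [← EReal.coe_le_coe_iff, ← hV']
    exact value_le fun w μ T ξ hw hμ hT hξ => EReal.coe_le_coe_iff.2 (hb w μ T ξ hw hμ hT hξ)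
  have V0 : ∀ x, 0 ≤ V x := fun x => by
    have := hge x
    rwa [hV', EReal.coe_nonneg] at this
  refine ⟨V, hV', V0, fun x => ?_, fun τ hτ x w μ ξ hw hμ _ hξ => ?_, fun τ hτ g hg x => ?_⟩
  · have := hle x
    rwa [hV', EReal.coe_le_coe_iff] at this
  · rw [← le_sub_iff_add_le']
    refine leV fun w' μ' T ξ' hw' hμ' hT hξ' => ?_
    obtain ⟨h1, h2⟩ := hξ.concat hτ hT.le hw hw' hμ hμ' hξ'
    have := run (by linarith) (hw.concat hw' hτ) (measurable_concatAt hμ hμ' τ) h1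
    linarith
  · refine leV fun w μ T ξ hw hμ hT hξ => ?_
    rcases lt_or_ge τ T with hlt | hge
    · obtain ⟨h1, h2, h3⟩ := hξ.split hτ.le hlt.le hw hμ
      have hμ' : Measurable fun t => μ (t + τ) := hμ.comp (measurable_add_const τ)
      have e1 := run (by linarith) (hw.shift hτ.le) hμ' h2
      have e2 := hg x w μ ξ hw hμ (fun _ => Set.mem_univ _) h1
      linarith
    -- A trajectory shorter than `τ` is prolonged to length `τ` without disturbance, which can only
    -- raise its payoff; `V ≥ 0` at the new endpoint then allows `hg` to be used.
    · obtain ⟨w', ξ', hw', hξ'⟩ := h.exists_undisturbed m₀ (ξ T)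
      obtain ⟨h1, h2⟩ := hξ' (τ - T) (by linarith)
      obtain ⟨h3, h4⟩ := hξ.concat hT.le (by linarith : 0 ≤ τ - T) hw hw' hμ measurable_const h1
      rw [add_sub_cancel] at h3 h4
      have e2 := hg x _ _ _ (hw.concat hw' hT.le) (measurable_concatAt hμ measurable_const T)
        (fun _ => Set.mem_univ _) h3
      have e3 := V0 (concatAt T ξ ξ' τ)
      linarith

end SwitchingLQ

namespace SwitchingLQ

variable {n k M : ℕ} {p : SwitchingLQ n k M} {cA β cD mD lam : ℝ}

/-! ### The max-plus iterates -/

theorem semigroupAt_le {m : Fin M} {τ : ℝ} {F : (Fin n → ℝ) → EReal} {f g : (Fin n → ℝ) → ℝ}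
    (hF : ∀ x, F x ≤ f x) (h : p.Dominates {m} τ f g) (x : Fin n → ℝ) :
    p.semigroupAt m τ F x ≤ g x := by
  refine iSup_le fun w => iSup_le fun hw => iSup_le fun ξ => iSup_le fun hξ => ?_
  refine (add_le_add_right (hF (ξ τ)) _).trans ?_
  rw [← EReal.coe_add, EReal.coe_le_coe_iff]
  exact h x w _ ξ hw measurable_const (fun _ => rfl) hξ

theorem le_semigroupAt {m : Fin M} {τ : ℝ} {F : (Fin n → ℝ) → EReal} {f : (Fin n → ℝ) → ℝ}
    (hF : ∀ x, (f x : EReal) ≤ F x) {x : Fin n → ℝ} {w : ℝ → Fin k → ℝ} {ξ : ℝ → Fin n → ℝ}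
    (hw : IsDisturbance w) (hξ : p.IsTrajectory x τ w (fun _ => m) ξ) {b : ℝ}
    (hb : b ≤ p.running τ w (fun _ => m) ξ + f (ξ τ)) :
    (b : EReal) ≤ p.semigroupAt m τ F x := by
  refine (EReal.coe_le_coe_iff.2 hb).trans ?_
  rw [EReal.coe_add]
  exact (add_le_add_right (hF (ξ τ)) _).trans <|
    le_iSup_of_le w <| le_iSup_of_le hw <| le_iSup_of_le ξ <| le_iSup_of_le hξ le_rfl

theorem semigroupAt_mono {m : Fin M} {τ : ℝ} {F G : (Fin n → ℝ) → EReal} (hFG : ∀ x, F x ≤ G x)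
    (x : Fin n → ℝ) : p.semigroupAt m τ F x ≤ p.semigroupAt m τ G x :=
  iSup_mono fun _ => iSup_mono fun _ => iSup_mono fun ξ => iSup_mono fun _ =>
    add_le_add_right (hFG (ξ τ)) _

theorem propagate_succ (τ : ℝ) {N : ℕ} (i : Fin (N + 1) → Fin M) (F : (Fin n → ℝ) → EReal) :
    p.propagate τ i F =
      p.semigroupAt (i (Fin.last N)) τ (p.propagate τ (fun j => i j.castSucc) F) := by
  rw [propagate, List.ofFn_succ', List.concat_eq_append, List.foldl_append]
  rfl

theorem maxPlusIterate_succ (τ : ℝ) (N : ℕ) (F : (Fin n → ℝ) → EReal) :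
    p.maxPlusIterate τ (N + 1) F = p.maxPlusStep τ (p.maxPlusIterate τ N F) :=
  Function.iterate_succ_apply' _ _ _

theorem propagate_le_maxPlusIterate (τ : ℝ) {N : ℕ} (i : Fin N → Fin M)
    (F : (Fin n → ℝ) → EReal) (x : Fin n → ℝ) :
    p.propagate τ i F x ≤ p.maxPlusIterate τ N F x := by
  induction N generalizing x with
  | zero => simp [propagate, maxPlusIterate]
  | succ N ih =>
    rw [propagate_succ, maxPlusIterate_succ]
    exact (semigroupAt_mono (ih _) x).trans
      (le_iSup (fun m => p.semigroupAt m τ (p.maxPlusIterate τ N F) x) _)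

theorem maxPlusIterate_le_of_dominates {τ : ℝ} {F : (Fin n → ℝ) → EReal}
    {f : ℕ → (Fin n → ℝ) → ℝ} (h0 : ∀ x, F x ≤ f 0 x)
    (hf : ∀ j, p.Dominates Set.univ τ (f j) (f (j + 1))) (N : ℕ) (x : Fin n → ℝ) :
    p.maxPlusIterate τ N F x ≤ f N x := by
  induction N generalizing x with
  | zero => exact h0 x
  | succ N ih =>
    rw [maxPlusIterate_succ]
    exact iSup_le fun m => semigroupAt_le ih
      (fun x w μ ξ hw hμ _ hξ => hf N x w μ ξ hw hμ (fun _ => Set.mem_univ _) hξ) x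

/-- All quantitative estimates on the method with time step `τ` and `N` iterations. -/
theorem CoreBounds.exists_estimates (h : p.CoreBounds cA β cD mD lam) (hM : 0 < M) :
    ∃ V : (Fin n → ℝ) → ℝ, (∀ x, p.value x = (V x : EReal)) ∧
    ∃ κ c T₀ : ℝ, 0 < κ ∧ κ ≤ 1 ∧ 0 < c ∧ 0 < T₀ ∧ T₀ ≤ 1 ∧ c * T₀ ≤ 1 ∧
      ∀ τ, 0 < τ → τ ≤ T₀ → ∀ P₀, SymmBetween P₀ lam → ∀ N : ℕ,
      (∀ i : Fin N → Fin M, SymmBetween (p.eulerWord τ P₀ i) lam) ∧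
      (∀ x, ∃ i : Fin N → Fin M, V x ≤ (1 + c * τ) * quadForm (p.eulerWord τ P₀ i) x +
        (1 - κ * τ) ^ N / κ * quadForm (lam • 1) x) ∧
      (∀ (i : Fin N → Fin M) x,
        (((1 - c * τ) * quadForm (p.eulerWord τ P₀ i) x : ℝ) : EReal) ≤
          p.propagate τ i (quadFun P₀) x ∧
        p.propagate τ i (quadFun P₀) x ≤
          (((1 + c * τ) * quadForm (p.eulerWord τ P₀ i) x : ℝ) : EReal)) ∧
      (∀ x, p.maxPlusIterate τ N (quadFun P₀) x ≤
        ((V x + (1 - κ * τ) ^ N * quadForm (lam • 1) x : ℝ) : EReal)) := by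
  obtain ⟨V, hV, V0, Vg, VV, Vdom⟩ := h.exists_value hM
  obtain ⟨κ, hκ0, hκ1, hκ⟩ := h.exists_rate
  obtain ⟨c, T₀, hc, hT₀, hT₀1, hcT₀, hE⟩ := h.exists_euler_bounds
  refine ⟨V, hV, κ, c, T₀, hκ0, hκ1, hc, hT₀, hT₀1, hcT₀, fun τ hτ hτT P₀ hP₀ => ?_⟩
  have : Nonempty (Fin M) := ⟨⟨0, hM⟩⟩
  have hτ1 := hτT.trans hT₀1
  have hg0 := h.quadForm_lam_nonneg
  set g : (Fin n → ℝ) → ℝ := quadForm (lam • (1 : Matrix (Fin n) (Fin n) ℝ)) with hg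
  have hgdom := h.dominates_lam hκ0.le hκ1 hκ hτ.le hτ1 Set.univ
  have hr0 : 0 ≤ 1 - κ * τ := by nlinarith
  have hr1 : 1 - κ * τ ≤ 1 := by nlinarith
  have hbet : ∀ N (i : Fin N → Fin M), SymmBetween (p.eulerWord τ P₀ i) lam := by
    intro N
    induction N with
    | zero => intro i; rwa [eulerWord_zero]
    | succ N ih =>
      intro i
      rw [eulerWord_succ]
      exact (hE τ hτ hτT _ (ih _)).1 _
  set H : ℕ → (Fin n → ℝ) → ℝ := fun j x =>
    ⨆ i : Fin j → Fin M, (1 + c * τ) * quadForm (p.eulerWord τ P₀ i) x with hH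
  have leH : ∀ j (i : Fin j → Fin M) x,
      (1 + c * τ) * quadForm (p.eulerWord τ P₀ i) x ≤ H j x := fun j i x =>
    le_ciSup (f := fun i : Fin j → Fin M => (1 + c * τ) * quadForm (p.eulerWord τ P₀ i) x)
      (Set.finite_range _).bddAbove i
  have Hdom : ∀ j, p.Dominates Set.univ τ (H j) (H (j + 1)) := by
    intro j x w μ ξ hw hμ _ hξ
    -- The best word `i` at the terminal state is fixed first. Appending to it any index visited by
    -- `μ` gives a word of length `j + 1`, so the upper Euler bound applies with `b = H (j + 1) x`.
    obtain ⟨i, hi⟩ := exists_eq_ciSup_of_finite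
      (f := fun i : Fin j → Fin M => (1 + c * τ) * quadForm (p.eulerWord τ P₀ i) (ξ τ))
    have : H j (ξ τ) = (1 + c * τ) * quadForm (p.eulerWord τ P₀ i) (ξ τ) := hi.symm
    rw [this]
    refine (hE τ hτ hτT _ (hbet j i)).2.1 x w μ ξ hw hμ hξ _ fun t => ?_
    have := leH (j + 1) (Fin.snoc i (μ t)) x
    rw [eulerWord_succ] at this
    simpa using this
  -- Since `V ≤ g`, one unit of time already makes `V` smaller than `g` by a definite factor. This
  -- starts the induction below.
  have Vκ : ∀ x, V x ≤ (1 - κ) * g x := by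
    refine Vdom 1 one_pos _ fun x w μ ξ hw hμ hU hξ => ?_
    have := h.dominates_lam hκ0.le hκ1 hκ zero_le_one le_rfl Set.univ x w μ ξ hw hμ hU hξ
    rw [mul_one] at this
    linarith [Vg (ξ 1)]
  intro N
  refine ⟨hbet N, ?_, ?_, ?_⟩
  -- With `s_j = (1 - κτ)^j / κ`, the claim bounds `V` by the convex combination `(H_j + s_j g) / (1
  -- + s_j)`. A time step turns `H_j` into `H_{j+1}` and `s_j g` into `s_{j+1} g`, and domination
  -- passes to convex combinations. The value `s_0 = 1/κ` is chosen so that `V ≤ (1 - κ) g ≤ g / (1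
  -- + κ)` gives the case `j = 0` with only `H_0 ≥ 0`.
  · have key : ∀ j x, (1 + (1 - κ * τ) ^ j / κ) * V x ≤ H j x + (1 - κ * τ) ^ j / κ * g x := by
      intro j
      induction j with
      | zero =>
        intro x
        have e1 : 0 ≤ H 0 x := (mul_nonneg (by positivity) (by
          rw [eulerWord_zero, quadForm]
          exact mul_nonneg (by norm_num) (hP₀.nonneg x))).trans (leH 0 Fin.elim0 x)
        have e2 : (κ + 1) * V x ≤ g x := by
          nlinarith [mul_le_mul_of_nonneg_left (Vκ x) (by linarith : 0 ≤ κ + 1), hg0 x,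
            mul_nonneg (sq_nonneg κ) (hg0 x)]
        have e3 : (1 + (1 - κ * τ) ^ 0 / κ) * V x = ((κ + 1) * V x) / κ := by
          field_simp
        have e4 : (1 - κ * τ) ^ 0 / κ * g x = g x / κ := by rw [pow_zero]; ring
        rw [e3, e4]
        have := div_le_div_of_nonneg_right e2 hκ0.le
        linarith
      | succ j ih =>
        set s := (1 - κ * τ) ^ j / κ with hs
        have hs0 : 0 ≤ s := by positivity
        have hs' : (1 - κ * τ) ^ (j + 1) / κ = s * (1 - κ * τ) := by rw [pow_succ, hs]; ring
        have dom : p.Dominates Set.univ τ V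
            (fun x => (H (j + 1) x + s * ((1 - κ * τ) * g x)) / (1 + s)) := by
          intro x w μ ξ hw hμ hU hξ
          rw [le_div_iff₀ (by linarith)]
          have e1 := ih (ξ τ)
          have e2 := Hdom j x w μ ξ hw hμ hU hξ
          have e3 := mul_le_mul_of_nonneg_left (hgdom x w μ ξ hw hμ hU hξ) hs0
          linarith
        intro x
        have e1 := Vdom τ hτ _ dom x
        rw [le_div_iff₀ (by linarith)] at e1
        have e2 : 0 ≤ s * (κ * τ) * V x := mul_nonneg (by positivity) (V0 x)
        rw [hs']
        linarith
    intro x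
    obtain ⟨i, hi⟩ := exists_eq_ciSup_of_finite
      (f := fun i : Fin N → Fin M => (1 + c * τ) * quadForm (p.eulerWord τ P₀ i) x)
    refine ⟨i, ?_⟩
    have e1 := key N x
    have e2 : H N x = (1 + c * τ) * quadForm (p.eulerWord τ P₀ i) x := hi.symm
    have e3 : 0 ≤ (1 - κ * τ) ^ N / κ * V x := mul_nonneg (by positivity) (V0 x)
    linarith
  · induction N with
    | zero =>
      intro i x
      have hq : 0 ≤ quadForm P₀ x := mul_nonneg (by norm_num) (hP₀.nonneg x)
      have ha : 0 ≤ c * τ * quadForm P₀ x := by positivity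
      simp only [eulerWord_zero, propagate, List.ofFn_zero, List.foldl_nil, quadFun_eq_coe,
        EReal.coe_le_coe_iff]
      constructor <;> linarith
    | succ N ih =>
      intro i x
      obtain ⟨_, hup, hlow⟩ := hE τ hτ hτT _ (hbet N fun j => i j.castSucc)
      rw [propagate_succ, eulerWord_succ]
      constructor
      · obtain ⟨w, ξ, hw, hξ, hb⟩ := hlow x (i (Fin.last N))
        exact le_semigroupAt (f := fun y => (1 - c * τ) *
          quadForm (p.eulerWord τ P₀ fun j => i j.castSucc) y) (fun y => (ih _ y).1) hw hξ hb
      · refine semigroupAt_le (f := fun y => (1 + c * τ) *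
          quadForm (p.eulerWord τ P₀ fun j => i j.castSucc) y) (g := fun y => (1 + c * τ) *
          quadForm (p.euler τ (p.eulerWord τ P₀ fun j => i j.castSucc) (i (Fin.last N))) y)
          (fun y => (ih _ y).2) ?_ x
        intro x w μ ξ hw hμ hU hξ
        exact hup x w μ ξ hw hμ hξ _ fun t => by rw [Set.mem_singleton_iff.1 (hU t)]
  · intro x
    -- The majorant is a convex combination of `V`, which dominates itself, and `g`, which
    -- contracts; it equals `g`, hence is above the initial function, at `j = 0`.
    have key := maxPlusIterate_le_of_dominates (p := p) (τ := τ) (F := quadFun P₀)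
      (f := fun j x => (1 - (1 - κ * τ) ^ j) * V x + (1 - κ * τ) ^ j * g x) ?_ ?_ N x
    · refine key.trans (EReal.coe_le_coe_iff.2 ?_)
      have : 0 ≤ (1 - κ * τ) ^ N * V x := mul_nonneg (by positivity) (V0 x)
      linarith
    · intro y
      rw [quadFun_eq_coe, EReal.coe_le_coe_iff]
      have := hP₀.le y
      simp only [pow_zero, sub_self, zero_mul, one_mul, zero_add, hg, quadForm_smul, quadForm_one]
      rw [quadForm]
      linarith
    · intro j x w μ ξ hw hμ hU hξ
      have hs0 : 0 ≤ (1 - κ * τ) ^ j := by positivity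
      have hs1 : (1 - κ * τ) ^ j ≤ 1 := pow_le_one₀ hr0 hr1
      have e1 := mul_le_mul_of_nonneg_left (VV τ hτ.le x w μ ξ hw hμ hU hξ) (sub_nonneg.2 hs1)
      have e2 := mul_le_mul_of_nonneg_left (hgdom x w μ ξ hw hμ hU hξ) hs0
      have e3 : 0 ≤ (1 - κ * τ) ^ j * (κ * τ) * V x := mul_nonneg (by positivity) (V0 x)
      simp only [pow_succ]
      linarith

/-- Convergence of the max-plus method, with the number of iterations needed. -/
theorem CoreBounds.exists_accuracy (h : p.CoreBounds cA β cD mD lam) (hM : 0 < M) :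
    ∃ C : ℝ, 0 < C ∧ ∀ᶠ ε in 𝓝[>] (0 : ℝ), ∃ (τ : ℝ) (N : ℕ), 0 < τ ∧
      (N : ℝ) ≤ C * (-Real.log ε / ε) ∧
      ∀ P₀, SymmBetween P₀ lam →
        ApproxWithin ε p.value (p.maxPlusIterate τ N (quadFun P₀)) ∧
        (∀ i : Fin N → Fin M, ApproxWithin ε (p.propagate τ i (quadFun P₀))
          (quadFun (p.eulerWord τ P₀ i))) ∧
        ApproxWithin ε p.value
          (fun x => ⨆ i : Fin N → Fin M, quadFun (p.eulerWord τ P₀ i) x) := by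
  obtain ⟨V, hV, κ, c, T₀, hκ0, hκ1, hc, hT₀, hT₀1, hcT₀, hest⟩ := h.exists_estimates hM
  have hl := h.lam_pos
  refine ⟨4 * c * lam / κ + 1, by positivity, ?_⟩
  -- The three bounds give, in order, `τ ≤ T₀`, the inequality `ε² lam / κ ≤ ε`, and `-log ε ≥ 1`.
  -- The last lets the rounding of `N` be absorbed by the summand `1` of `C`.
  have hsmall : ∀ᶠ ε in 𝓝[>] (0 : ℝ),
      ε ∈ Set.Ioo 0 (min (2 * c * lam * T₀) (min (κ / lam) (Real.exp (-1)))) :=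
    Ioo_mem_nhdsGT (by positivity)
  filter_upwards [hsmall] with ε hε
  have hε0 : 0 < ε := hε.1
  have hε1 : ε ≤ 2 * c * lam * T₀ := hε.2.le.trans (min_le_left _ _)
  have hε2 : ε ≤ κ / lam := hε.2.le.trans ((min_le_right _ _).trans (min_le_left _ _))
  have hε3 : ε ≤ Real.exp (-1) := hε.2.le.trans ((min_le_right _ _).trans (min_le_right _ _))
  have hlog : 1 ≤ -Real.log ε := by
    have := Real.log_le_log hε0 hε3
    rw [Real.log_exp] at this
    linarith
  have hε4 : ε ≤ 1 := hε3.trans (Real.exp_le_one_iff.2 (by norm_num))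
  -- With this `τ` the Euler factors contribute `2cτ · ½ lam = ε/2`. The choice of `N` below makes
  -- `(1 - κτ)^N ≤ ε²`, and the forgetting error is then at most the other `ε/2`.
  obtain ⟨τ, hτ⟩ : ∃ τ, τ = ε / (2 * c * lam) := ⟨_, rfl⟩
  have hτ0 : 0 < τ := by rw [hτ]; positivity
  have hτT : τ ≤ T₀ := by rw [hτ, div_le_iff₀ (by positivity)]; linarith
  have hτε : 2 * (c * τ) * lam = ε := by rw [hτ]; field_simp
  obtain ⟨N, hN⟩ : ∃ N, N = ⌈2 * -Real.log ε / (κ * τ)⌉₊ := ⟨_, rfl⟩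
  have hN1 : 2 * -Real.log ε / (κ * τ) ≤ N := hN ▸ Nat.le_ceil _
  have hN2 : (N : ℝ) ≤ 2 * -Real.log ε / (κ * τ) + 1 :=
    hN ▸ (Nat.ceil_lt_add_one (by positivity)).le
  refine ⟨τ, N, hτ0, ?_, fun P₀ hP₀ => ?_⟩
  · have e1 : 2 * -Real.log ε / (κ * τ) = 4 * c * lam / κ * (-Real.log ε / ε) := by
      rw [hτ]; field_simp; ring
    have e2 : 1 ≤ -Real.log ε / ε := by
      rw [le_div_iff₀ hε0]; linarith
    rw [e1] at hN2
    linarith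
  obtain ⟨hbet, hupper, hprop, hiter⟩ := hest τ hτ0 hτT P₀ hP₀ N
  set s := (1 - κ * τ) ^ N with hs
  have hκτ : κ * τ ≤ 1 := by nlinarith
  have hs0 : 0 ≤ s := pow_nonneg (by linarith) N
  have hsε : s ≤ ε ^ 2 := by
    have e1 : s ≤ Real.exp (-(κ * τ)) ^ N :=
      pow_le_pow_left₀ (by linarith) (Real.one_sub_le_exp_neg _) N
    refine e1.trans ?_
    rw [← Real.exp_nat_mul, ← Real.exp_log (pow_pos hε0 2), Real.exp_le_exp, Real.log_pow]
    rw [div_le_iff₀ (by positivity)] at hN1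
    push_cast
    linarith
  have hsκ : s ≤ s / κ := by rw [le_div_iff₀ hκ0]; nlinarith
  have herr : 2 * (c * τ) * lam + s / κ * lam ≤ 2 * ε := by
    have : s / κ * lam ≤ ε := by
      rw [le_div_iff₀ hl] at hε2
      rw [div_mul_eq_mul_div, div_le_iff₀ hκ0]
      nlinarith [mul_le_mul_of_nonneg_right hsε hl.le]
    linarith
  have hcτ1 : c * τ ≤ 1 := (mul_le_mul_of_nonneg_left hτT hc.le).trans hcT₀
  have hcτ0 : 0 < c * τ := by positivity
  obtain ⟨a, ha⟩ : ∃ a, a = c * τ := ⟨_, rfl⟩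
  rw [← ha] at herr hcτ1 hcτ0 hupper hprop
  set G : (Fin n → ℝ) → ℝ := quadForm (lam • (1 : Matrix (Fin n) (Fin n) ℝ)) with hG
  have hGx : ∀ x, G x = (1 / 2) * lam * (x ⬝ᵥ x) := fun x => by
    rw [hG, quadForm_smul, quadForm_one]; ring
  have hG0 : ∀ x, 0 ≤ G x := h.quadForm_lam_nonneg
  have hq0 : ∀ (i : Fin N → Fin M) x, 0 ≤ quadForm (p.eulerWord τ P₀ i) x := fun i x =>
    mul_nonneg (by norm_num) ((hbet i).nonneg x)
  have hqG : ∀ (i : Fin N → Fin M) x, quadForm (p.eulerWord τ P₀ i) x ≤ G x := fun i x => by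
    rw [hGx, quadForm]
    linarith [(hbet i).le x]
  have haq : ∀ (i : Fin N → Fin M) x, a * quadForm (p.eulerWord τ P₀ i) x ≤ a * G x :=
    fun i x => mul_le_mul_of_nonneg_left (hqG i x) hcτ0.le
  have haq0 : ∀ (i : Fin N → Fin M) x, 0 ≤ a * quadForm (p.eulerWord τ P₀ i) x :=
    fun i x => mul_nonneg hcτ0.le (hq0 i x)
  have hfin : ∀ x, 2 * (a * G x) + s / κ * G x ≤ ε * (x ⬝ᵥ x) := fun x => by
    rw [hGx]
    have := mul_le_mul_of_nonneg_right herr (dotProduct_self_nonneg' x)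
    linarith
  have hsG : ∀ x, s * G x ≤ s / κ * G x := fun x => mul_le_mul_of_nonneg_right hsκ (hG0 x)
  have hsG0 : ∀ x, 0 ≤ s * G x := fun x => mul_nonneg hs0 (hG0 x)
  have haG0 : ∀ x, 0 ≤ a * G x := fun x => mul_nonneg hcτ0.le (hG0 x)
  have coe_of_between : ∀ {y : EReal} {b d : ℝ}, (b : EReal) ≤ y → y ≤ (d : EReal) →
      ∃ r : ℝ, y = (r : EReal) ∧ b ≤ r ∧ r ≤ d := by
    intro y b d h1 h2
    lift y to ℝ using ⟨ne_top_of_le_ne_top (EReal.coe_ne_top _) h2,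
      ne_bot_of_le_ne_bot (EReal.coe_ne_bot _) h1⟩
    exact ⟨y, rfl, EReal.coe_le_coe_iff.1 h1, EReal.coe_le_coe_iff.1 h2⟩
  -- Each propagated word lies below the max-plus iterate, which bounds the Euler matrices from
  -- above in terms of `V`.
  have hlow : ∀ (i : Fin N → Fin M) x,
      (1 - a) * quadForm (p.eulerWord τ P₀ i) x ≤ V x + s * G x := fun i x =>
    EReal.coe_le_coe_iff.1 (((hprop i x).1.trans (propagate_le_maxPlusIterate τ i _ x)).trans
      (hiter x))
  refine ⟨fun x => ?_, fun i x => ?_, fun x => ?_⟩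
  · obtain ⟨i, hi⟩ := hupper x
    obtain ⟨r, hr, hr1, hr2⟩ := coe_of_between
      ((hprop i x).1.trans (propagate_le_maxPlusIterate τ i _ x)) (hiter x)
    refine ⟨V x, r, hV x, hr, abs_le.2 ⟨?_, ?_⟩⟩
    · linarith [hfin x, hsG x, haG0 x]
    · linarith [hfin x, haq i x]
  · obtain ⟨r, hr, hr1, hr2⟩ := coe_of_between (hprop i x).1 (hprop i x).2
    refine ⟨r, _, hr, rfl, abs_le.2 ⟨?_, ?_⟩⟩
    · change _ ≤ r - quadForm _ _
      linarith [hfin x, haq i x, hsG x, hsG0 x, haG0 x]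
    · change r - quadForm _ _ ≤ _
      linarith [hfin x, haq i x, hsG x, hsG0 x, haG0 x]
  · obtain ⟨i, hi⟩ := hupper x
    have h1 : (quadForm (p.eulerWord τ P₀ i) x : EReal) ≤
        ⨆ i : Fin N → Fin M, quadFun (p.eulerWord τ P₀ i) x :=
      le_iSup (fun i : Fin N → Fin M => quadFun (p.eulerWord τ P₀ i) x) i
    have h2 : (⨆ i : Fin N → Fin M, quadFun (p.eulerWord τ P₀ i) x) ≤
        ((V x + s * G x + a * G x : ℝ) : EReal) := iSup_le fun j => by
      rw [quadFun_eq_coe, EReal.coe_le_coe_iff]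
      linarith [hlow j x, haq j x]
    obtain ⟨r, hr, hr1, hr2⟩ := coe_of_between h1 h2
    refine ⟨V x, r, hV x, hr, abs_le.2 ⟨?_, ?_⟩⟩
    · linarith [hfin x, hsG x, haG0 x]
    · linarith [hfin x, haq i x, haG0 x]

end SwitchingLQ

namespace SwitchingLQ

variable {n k M : ℕ} {p : SwitchingLQ n k M}

/-! ### The constants -/

theorem symmBetween_of_mem_loewnerInterval {e lam₀ lam : ℝ} (he : 0 ≤ e) (hl : lam₀ ≤ lam)
    {P : Matrix (Fin n) (Fin n) ℝ} (hP : P ∈ loewnerInterval n e lam₀) : SymmBetween P lam := by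
  obtain ⟨h1, h2⟩ := hP
  have e1 : ∀ x, e * (x ⬝ᵥ x) ≤ x ⬝ᵥ (P *ᵥ x) := by
    intro x
    have := h1.dotProduct_mulVec_nonneg x
    simp only [star_trivial, Matrix.sub_mulVec, Matrix.smul_mulVec, Matrix.one_mulVec,
      dotProduct_sub, dotProduct_smul, smul_eq_mul] at this
    linarith
  have e2 : ∀ x, x ⬝ᵥ (P *ᵥ x) ≤ lam₀ * (x ⬝ᵥ x) := by
    intro x
    have := h2.dotProduct_mulVec_nonneg x
    simp only [star_trivial, Matrix.sub_mulVec, Matrix.smul_mulVec, Matrix.one_mulVec,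
      dotProduct_sub, dotProduct_smul, smul_eq_mul] at this
    linarith
  refine ⟨?_, fun x => (mul_nonneg he (dotProduct_self_nonneg' x)).trans (e1 x),
    fun x => (e2 x).trans (mul_le_mul_of_nonneg_right hl (dotProduct_self_nonneg' x))⟩
  have h3 := h1.isHermitian
  rw [Matrix.IsHermitian, Matrix.conjTranspose_eq_transpose_of_trivial, Matrix.transpose_sub,
    Matrix.transpose_smul, Matrix.transpose_one] at h3
  exact sub_left_injective h3

/-- The assumptions provide constants as in `CoreBounds`, with a bound `lam` above the initial
matrices. -/
theorem exists_coreBounds {cA cσ cD mD lam₀ e : ℝ} (hM : 0 < M) (h1 : p.Assumption1 cA cσ cD)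
    (h2 : p.Assumption2 cA cσ cD mD) (hl : lam₀ < √(mD * p.γ ^ 2 / cσ ^ 2)) (he : 0 < e) :
    ∃ cA β cD mD lam, p.CoreBounds cA β cD mD lam ∧
      ∀ P ∈ loewnerInterval n e lam₀, SymmBetween P lam := by
  have hγ := h1.γ_pos
  have hcσ := h1.cσ_pos
  have hcA := h1.cA_pos
  have hmD := h2.mD_pos
  obtain ⟨β, hβ⟩ : ∃ β, β = cσ ^ 2 / p.γ ^ 2 := ⟨_, rfl⟩
  have hβ0 : 0 < β := by rw [hβ]; positivity
  have hβγ : β * p.γ ^ 2 = cσ ^ 2 := by rw [hβ]; field_simp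
  have hsig : ∀ (m : Fin M) (w : Fin k → ℝ),
      (p.sig m *ᵥ w) ⬝ᵥ (p.sig m *ᵥ w) ≤ β * p.γ ^ 2 * (w ⬝ᵥ w) := by
    rw [hβγ]; exact h1.sig_le
  have hsymm : ∀ m : Fin M, (p.D m).IsSymm := fun m => by
    have := (h1.D_posDef m).isHermitian
    rwa [Matrix.IsHermitian, Matrix.conjTranspose_eq_transpose_of_trivial] at this
  -- In dimension zero the bounds on `D` are vacuous and do not give `mD ≤ cD`, so suitable
  -- constants are chosen by hand.
  rcases Nat.eq_zero_or_pos n with rfl | hn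
  · refine ⟨cA, β, 0, cA ^ 2 / β + 1, cA / β, ⟨hγ, hcA, hβ0, by positivity, h1.stable, hsig,
      hsymm, fun m x => by simp [dotProduct], fun m x => by simp [dotProduct], ?_, ?_⟩,
      fun P _ => ⟨by ext i; exact i.elim0, fun x => by simp [dotProduct],
        fun x => by simp [dotProduct]⟩⟩
    · have : -2 * cA * (cA / β) + β * (cA / β) ^ 2 + 0 = -(cA ^ 2 / β) := by field_simp; ring
      rw [this]
      exact neg_lt_zero.2 (by positivity)
    · have : β * (cA / β) ^ 2 = cA ^ 2 / β := by field_simp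
      rw [this]
      linarith
  have hmc : mD ≤ cD := by
    have e1 := h2.le_D ⟨0, hM⟩ (Pi.single ⟨0, hn⟩ 1)
    have e2 := h1.D_le ⟨0, hM⟩ (Pi.single ⟨0, hn⟩ 1)
    simpa using e1.trans e2
  have hgap1 : cD * β < cA ^ 2 := by
    have := h1.gap
    rwa [mul_div_assoc, ← hβ] at this
  have hgap2 := h2.gap
  rw [mul_div_assoc, ← hβ] at hgap2
  have hlam₂ : mD * p.γ ^ 2 / cσ ^ 2 = mD / β := by rw [hβ]; field_simp
  rw [hlam₂] at hl
  obtain ⟨d, hd⟩ : ∃ d, d = √(cA ^ 2 - cD * β) := ⟨_, rfl⟩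
  have hd0 : 0 < d := hd ▸ Real.sqrt_pos.2 (by linarith)
  have hd2 : d ^ 2 = cA ^ 2 - cD * β := hd ▸ Real.sq_sqrt (by linarith)
  rw [← hd] at hgap2
  have hcDβ : 0 < cD * β := mul_pos (by linarith) hβ0
  have hdA : d < cA := by nlinarith
  have hlam₁ : (cA - d) / β < √(mD / β) := by
    refine Real.lt_sqrt_of_sq_lt ?_
    rw [div_pow, div_lt_div_iff₀ (by positivity) hβ0]
    nlinarith
  -- `(cA ± d)/β` are the roots of `βλ² - 2cAλ + cD`. The second assumption puts the smaller root
  -- below `√(mD/β)`. The larger root needs no condition: the roots have product `cD/β ≥ mD/β >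
  -- lam²`, so `lam` cannot exceed both.
  obtain ⟨lam, hlam, hlam'⟩ := exists_between (max_lt hl hlam₁)
  have hr : (cA - d) / β < lam := (le_max_right _ _).trans_lt hlam
  have hlam0 : 0 < lam := (div_pos (by linarith) hβ0).trans hr
  have hlt : β * lam ^ 2 < mD := by
    have := (Real.lt_sqrt hlam0.le).1 hlam'
    rwa [lt_div_iff₀' hβ0] at this
  refine ⟨cA, β, cD, mD, lam, ⟨hγ, hcA, hβ0, hlam0, h1.stable, hsig, hsymm, h1.D_le, h2.le_D,
    ?_, hlt⟩, fun P hP =>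
      symmBetween_of_mem_loewnerInterval he.le ((le_max_left _ _).trans hlam.le) hP⟩
  rw [div_lt_iff₀' hβ0] at hr
  have hup : β * lam < cA + d := by
    by_contra hcon
    push Not at hcon
    have e1 : β * (β * lam ^ 2) < β * cD := mul_lt_mul_of_pos_left (by linarith) hβ0
    nlinarith
  have e1 : β * (-2 * cA * lam + β * lam ^ 2 + cD) < 0 := by nlinarith
  exact (mul_neg_iff.1 e1).elim (fun h => h.2) (fun h => absurd h.1 (by linarith))

end SwitchingLQ

/-! ### Counting arithmetic operations -/

/-- With `c` more operations, any straight-line program which provides the values in `B` provides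
the values in `T`. -/
def Obtains {X : Type} (B : Set (X → ℝ)) (c : ℕ) (T : Set (X → ℝ)) : Prop :=
  ∀ (I : Set (X → ℝ)) (t : ℕ) (G : Set (X → ℝ)), StraightLine I t G → B ⊆ G →
    ∃ G', G ⊆ G' ∧ T ⊆ G' ∧ StraightLine I (t + c) G'

namespace Obtains

variable {X : Type} {B B' T T' : Set (X → ℝ)} {c c' : ℕ} {f g : X → ℝ}

theorem of_subset (h : T ⊆ B) : Obtains B 0 T := fun _ _ G hG hB =>
  ⟨G, subset_rfl, h.trans hB, hG⟩

theorem mono (h : Obtains B c T) (hB : B ⊆ B') (hT : T' ⊆ T) : Obtains B' c T' := by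
  intro I t G hG hBG
  obtain ⟨G', h1, h2, h3⟩ := h I t G hG (hB.trans hBG)
  exact ⟨G', h1, hT.trans h2, h3⟩

theorem trans (h : Obtains B c T) (h' : Obtains (B ∪ T) c' T') :
    Obtains B (c + c') (T ∪ T') := by
  intro I t G hG hB
  obtain ⟨G₁, h1, h2, h3⟩ := h I t G hG hB
  obtain ⟨G₂, h4, h5, h6⟩ := h' I _ G₁ h3 (Set.union_subset (hB.trans h1) h2)
  exact ⟨G₂, h1.trans h4, Set.union_subset (h2.trans h4) h5, by rwa [← add_assoc]⟩

theorem trans' (h : Obtains B c T) (h' : Obtains (B ∪ T) c' T') : Obtains B (c + c') T' :=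
  (h.trans h').mono subset_rfl Set.subset_union_right

theorem bind (h : Obtains B c T) (h' : ∀ B', B ⊆ B' → T ⊆ B' → Obtains B' c' T') :
    Obtains B (c + c') T' :=
  h.trans' (h' _ Set.subset_union_left Set.subset_union_right)

theorem add (hf : f ∈ B) (hg : g ∈ B) : Obtains B 1 {fun x => f x + g x} :=
  fun _ _ _ hG hB => ⟨_, Set.subset_insert _ _, by simp, hG.add (hB hf) (hB hg)⟩

theorem mul (hf : f ∈ B) (hg : g ∈ B) : Obtains B 1 {fun x => f x * g x} :=
  fun _ _ _ hG hB => ⟨_, Set.subset_insert _ _, by simp, hG.mul (hB hf) (hB hg)⟩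

theorem biUnion {ι : Type*} (s : Finset ι) {T : ι → Set (X → ℝ)}
    (h : ∀ i ∈ s, Obtains B c (T i)) : Obtains B (s.card * c) (⋃ i ∈ s, T i) := by
  classical
  induction s using Finset.induction_on with
  | empty =>
    have : Obtains B 0 (∅ : Set (X → ℝ)) := of_subset (Set.empty_subset B)
    simpa using this
  | insert a s ha ih =>
    rw [Finset.card_insert_of_notMem ha, add_mul, one_mul, Finset.set_biUnion_insert,
      Set.union_comm]
    exact (ih fun i hi => h i (by simp [hi])).trans
      ((h a (by simp)).mono Set.subset_union_left subset_rfl)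

theorem iUnion {ι : Type*} [Fintype ι] {T : ι → Set (X → ℝ)} (h : ∀ i, Obtains B c (T i)) :
    Obtains B (Fintype.card ι * c) (⋃ i, T i) := by
  simpa using biUnion Finset.univ fun i _ => h i

/-- Each term costs one multiplication and one addition, the sum being started at the constant `0`.
-/
theorem sum_mul {n : ℕ} {f g : Fin n → X → ℝ} (h0 : (fun _ => 0) ∈ B) (hf : ∀ j, f j ∈ B)
    (hg : ∀ j, g j ∈ B) : Obtains B (2 * n) {fun x => ∑ j, f j x * g j x} := by
  induction n with
  | zero => exact of_subset (by simpa using h0)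
  | succ n ih =>
    have h1 := ih (f := fun j => f j.castSucc) (g := fun j => g j.castSucc)
      (fun j => hf _) (fun j => hg _)
    have h2 := h1.trans ((mul (hf (Fin.last n)) (hg (Fin.last n))).mono Set.subset_union_left
      subset_rfl)
    have h3 := h2.trans' (add (f := fun x => ∑ j : Fin n, f j.castSucc x * g j.castSucc x)
      (g := fun x => f (Fin.last n) x * g (Fin.last n) x) (by simp) (by simp))
    simp only [Fin.sum_univ_castSucc]
    exact h3

end Obtains

/-- The set of the entries of a matrix which depends on the input. -/
def matrixEntries {X : Type} {n : ℕ} (F : X → Matrix (Fin n) (Fin n) ℝ) : Set (X → ℝ) :=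
  ⋃ ij : Fin n × Fin n, {fun x => F x ij.1 ij.2}

theorem matrixEntries_subset {X : Type} {n : ℕ} {F : X → Matrix (Fin n) (Fin n) ℝ}
    {B : Set (X → ℝ)} : matrixEntries F ⊆ B ↔ ∀ i j, (fun x => F x i j) ∈ B := by
  simp [matrixEntries, Set.range_subset_iff]

namespace Obtains

variable {X : Type} {n : ℕ} {B : Set (X → ℝ)} {F G : X → Matrix (Fin n) (Fin n) ℝ}

theorem matrix_mul (h0 : (fun _ => 0) ∈ B) (hF : matrixEntries F ⊆ B) (hG : matrixEntries G ⊆ B) :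
    Obtains B (2 * n ^ 3) (matrixEntries fun x => F x * G x) := by
  rw [matrixEntries_subset] at hF hG
  have := iUnion fun ij : Fin n × Fin n => sum_mul h0 (fun l => hF ij.1 l) (fun l => hG l ij.2)
  rw [Fintype.card_prod, Fintype.card_fin] at this
  rw [show 2 * n ^ 3 = n * n * (2 * n) by ring]
  simpa only [matrixEntries, Matrix.mul_apply] using this

theorem matrix_add (hF : matrixEntries F ⊆ B) (hG : matrixEntries G ⊆ B) :
    Obtains B (n ^ 2) (matrixEntries fun x => F x + G x) := by
  rw [matrixEntries_subset] at hF hG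
  have := iUnion fun ij : Fin n × Fin n => add (hF ij.1 ij.2) (hG ij.1 ij.2)
  rw [Fintype.card_prod, Fintype.card_fin] at this
  rw [show n ^ 2 = n * n * 1 by ring]
  simpa only [matrixEntries, Matrix.add_apply] using this

theorem matrix_smul {f : X → ℝ} (hf : f ∈ B) (hG : matrixEntries G ⊆ B) :
    Obtains B (n ^ 2) (matrixEntries fun x => f x • G x) := by
  rw [matrixEntries_subset] at hG
  have := iUnion fun ij : Fin n × Fin n => mul hf (hG ij.1 ij.2)
  rw [Fintype.card_prod, Fintype.card_fin] at this
  rw [show n ^ 2 = n * n * 1 by ring]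
  simpa only [matrixEntries, Matrix.smul_apply, smul_eq_mul] using this

end Obtains

/-! ### The straight-line program for the Euler scheme and its cost -/

namespace MethodInput

variable {n M : ℕ}

/-- One Euler step in terms of the numerical input. -/
def euler (X : MethodInput n M) (R : Matrix (Fin n) (Fin n) ℝ) (m : Fin M) :
    Matrix (Fin n) (Fin n) ℝ :=
  R + X.τ • riccati (X.A m) (X.D m) (X.S m) R

/-- The Euler scheme along a word in terms of the numerical input. -/
def eulerWord {N : ℕ} (i : Fin N → Fin M) (X : MethodInput n M) : Matrix (Fin n) (Fin n) ℝ :=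
  (List.ofFn i).foldl X.euler X.P

theorem eulerWord_succ {N : ℕ} (i : Fin (N + 1) → Fin M) (X : MethodInput n M) :
    eulerWord i X = X.euler (eulerWord (fun j => i j.castSucc) X) (i (Fin.last N)) := by
  rw [eulerWord, List.ofFn_succ', List.concat_eq_append, List.foldl_append]
  rfl

theorem obtains_euler {B : Set (MethodInput n M → ℝ)} (hB : initialValues n M ⊆ B)
    {R : MethodInput n M → Matrix (Fin n) (Fin n) ℝ} (hR : matrixEntries R ⊆ B) (m : Fin M) :
    Obtains B (8 * n ^ 3 + 5 * n ^ 2) (matrixEntries fun X => X.euler (R X) m) := by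
  have h0 : (fun _ => 0) ∈ B := hB (Or.inl ⟨0, by simp⟩)
  have hτ : (fun X : MethodInput n M => X.τ) ∈ B := hB (by simp [initialValues])
  have hA : matrixEntries (fun X : MethodInput n M => X.A m) ⊆ B :=
    matrixEntries_subset.2 fun i j => hB (Or.inr (Or.inl ⟨m, i, j, rfl⟩))
  have hA' : matrixEntries (fun X : MethodInput n M => (X.A m)ᵀ) ⊆ B :=
    matrixEntries_subset.2 fun i j => hB (Or.inr (Or.inl ⟨m, j, i, rfl⟩))
  have hD : matrixEntries (fun X : MethodInput n M => X.D m) ⊆ B :=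
    matrixEntries_subset.2 fun i j => hB (Or.inr (Or.inr (Or.inl ⟨m, i, j, rfl⟩)))
  have hS : matrixEntries (fun X : MethodInput n M => X.S m) ⊆ B :=
    matrixEntries_subset.2 fun i j => hB (Or.inr (Or.inr (Or.inr (Or.inl ⟨m, i, j, rfl⟩))))
  -- Four products (`A'R`, `RA`, `RΣ`, `(RΣ)R`), three sums for the Riccati operator, the scaling by
  -- `τ`, and the final sum with `R`.
  rw [show 8 * n ^ 3 + 5 * n ^ 2 = 2 * n ^ 3 + (2 * n ^ 3 + (2 * n ^ 3 + (2 * n ^ 3 + (n ^ 2 +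
    (n ^ 2 + (n ^ 2 + (n ^ 2 + n ^ 2))))))) by ring]
  refine (Obtains.matrix_mul h0 hA' hR).bind fun B₁ b1 t1 => ?_
  refine (Obtains.matrix_mul (b1 h0) (hR.trans b1) (hA.trans b1)).bind fun B₂ b2 t2 => ?_
  refine (Obtains.matrix_mul (b2 (b1 h0)) (hR.trans (b1.trans b2))
    (hS.trans (b1.trans b2))).bind fun B₃ b3 t3 => ?_
  have c3 := (b1.trans b2).trans b3
  refine (Obtains.matrix_mul (c3 h0) t3 (hR.trans c3)).bind fun B₄ b4 t4 => ?_
  refine (Obtains.matrix_add (t1.trans ((b2.trans b3).trans b4))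
    (t2.trans (b3.trans b4))).bind fun B₅ b5 t5 => ?_
  refine (Obtains.matrix_add t5 (t4.trans b5)).bind fun B₆ b6 t6 => ?_
  have c6 := ((c3.trans b4).trans b5).trans b6
  refine (Obtains.matrix_add t6 (hD.trans c6)).bind fun B₇ b7 t7 => ?_
  have c7 := c6.trans b7
  refine (Obtains.matrix_smul (c7 hτ) t7).bind fun B₈ b8 t8 => ?_
  exact Obtains.matrix_add (hR.trans (c7.trans b8)) t8

/-- The number of operations of the Euler scheme along all words of length `N`. -/
def eulerCost (n M N : ℕ) : ℕ :=
  ∑ j ∈ Finset.range N, M ^ (j + 1) * (8 * n ^ 3 + 5 * n ^ 2)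

theorem obtains_eulerWord (n M N : ℕ) :
    Obtains (initialValues n M) (eulerCost n M N)
      (⋃ i : Fin N → Fin M, matrixEntries (eulerWord (n := n) i)) := by
  induction N with
  | zero =>
    refine Obtains.of_subset (Set.iUnion_subset fun i => matrixEntries_subset.2 fun a b => ?_)
    simp only [eulerWord, List.ofFn_zero, List.foldl_nil]
    exact Or.inr (Or.inr (Or.inr (Or.inr (Or.inr ⟨a, b, rfl⟩))))
  | succ N ih =>
    rw [eulerCost, Finset.sum_range_succ]
    -- The matrices of all words of length `N` are kept, so that a word of length `N + 1` costs a
    -- single further Euler step.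
    refine ih.trans' ?_
    have := Obtains.iUnion (B := initialValues n M ∪
        ⋃ i : Fin N → Fin M, matrixEntries (eulerWord (n := n) i))
      fun i : Fin (N + 1) → Fin M => obtains_euler (n := n) Set.subset_union_left
        (R := eulerWord fun j => i j.castSucc)
        ((Set.subset_iUnion (fun i : Fin N → Fin M => matrixEntries (eulerWord (n := n) i))
          _).trans Set.subset_union_right) (i (Fin.last N))
    rw [Fintype.card_fun, Fintype.card_fin, Fintype.card_fin] at this
    have e : ∀ i : Fin (N + 1) → Fin M, eulerWord (n := n) i = fun X =>
        X.euler (eulerWord (fun j => i j.castSucc) X) (i (Fin.last N)) := fun i =>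
      funext (eulerWord_succ i)
    simpa only [e] using this

theorem computedWith_eulerWord (n M N : ℕ) :
    ComputedWith (fun i : Fin N → Fin M => eulerWord (n := n) i) (eulerCost n M N) := by
  obtain ⟨G, -, h2, h3⟩ := obtains_eulerWord n M N _ 0 _ .start subset_rfl
  rw [zero_add] at h3
  exact ⟨G, h3, fun i => matrixEntries_subset.1 ((Set.subset_iUnion _ i).trans h2)⟩

/-- For `M ≥ 2` the geometric sum over word lengths is at most twice its last term. -/
theorem eulerCost_le {M : ℕ} (hM : 2 ≤ M) (n N : ℕ) :
    eulerCost n M N ≤ 26 * M ^ N * n ^ 3 := by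
  have h1 : ∑ j ∈ Finset.range N, M ^ (j + 1) ≤ 2 * M ^ N := by
    induction N with
    | zero => simp
    | succ N ih =>
      rw [Finset.sum_range_succ]
      have : 2 * M ^ N ≤ M * M ^ N := Nat.mul_le_mul_right _ hM
      rw [pow_succ, mul_comm (M ^ N)]
      omega
  have h2 : n ^ 2 ≤ n ^ 3 := by
    rcases Nat.eq_zero_or_pos n with rfl | hn
    · simp
    · exact Nat.pow_le_pow_right hn (by norm_num)
  rw [eulerCost, ← Finset.sum_mul]
  calc _ ≤ 2 * M ^ N * (13 * n ^ 3) := Nat.mul_le_mul h1 (by omega)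
    _ = _ := by ring

end MethodInput

/-! ### The main theorem -/

theorem mainTheorem4 :
    ∃ (c : ℝ)
      (Q : ∀ n M N : ℕ, (Fin N → Fin M) → MethodInput n M → Matrix (Fin n) (Fin n) ℝ)
      (cost : ℕ → ℕ → ℕ → ℕ),
      (∀ n M N : ℕ, ComputedWith (Q n M N) (cost n M N)) ∧
      ∀ (n k M : ℕ) (p : SwitchingLQ n k M) (cA cσ cD mD lam e : ℝ),
        0 < M → p.Assumption1 cA cσ cD → p.Assumption2 cA cσ cD mD →
        lam < √(mD * p.γ ^ 2 / cσ ^ 2) → 0 < e →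
        ∃ C : ℝ, 0 < C ∧ ∀ᶠ ε in 𝓝[>] (0 : ℝ), ∃ (τ : ℝ) (N : ℕ), 0 < τ ∧
          -- the number of iterations
          (N : ℝ) ≤ C * (-Real.log ε / ε) ∧
          -- the number of arithmetic operations
          (2 ≤ M → (cost n M N : ℝ) ≤ c * (M : ℝ) ^ (C * (-Real.log ε / ε)) * (n : ℝ) ^ 3) ∧
          ∀ P₀ ∈ loewnerInterval n e lam,
            -- `N` iterations of the max-plus method approximate `V` to accuracy `ε`
            ApproxWithin ε p.value (p.maxPlusIterate τ N (quadFun P₀)) ∧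
            -- the program computes the quadratic functions of the method to accuracy `ε`
            (∀ i : Fin N → Fin M,
              ApproxWithin ε (p.propagate τ i (quadFun P₀))
                (quadFun (Q n M N i (p.input τ P₀)))) ∧
            -- and the supremum of its output approximates `V` to accuracy `ε`
            ApproxWithin ε p.value (fun x => ⨆ i, quadFun (Q n M N i (p.input τ P₀)) x) := by
  refine ⟨26, fun n M N i => MethodInput.eulerWord i, MethodInput.eulerCost,
    MethodInput.computedWith_eulerWord, ?_⟩
  intro n k M p cA cσ cD mD lam e hM h1 h2 hl he
  obtain ⟨cA', β, cD', mD', lam', hcore, hP⟩ := SwitchingLQ.exists_coreBounds hM h1 h2 hl he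
  obtain ⟨C, hC, hev⟩ := hcore.exists_accuracy hM
  refine ⟨C, hC, hev.mono ?_⟩
  rintro ε ⟨τ, N, hτ, hN, hacc⟩
  -- The program evaluated at `p.input τ P₀` is by definition the Euler scheme of `p`, so `hacc`
  -- applies as it stands.
  refine ⟨τ, N, hτ, hN, fun hM2 => ?_, fun P₀ hP₀ => hacc P₀ (hP P₀ hP₀)⟩
  have e1 : (MethodInput.eulerCost n M N : ℝ) ≤ 26 * (M : ℝ) ^ N * (n : ℝ) ^ 3 := by
    exact_mod_cast MethodInput.eulerCost_le hM2 n N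
  have e2 : (M : ℝ) ^ N ≤ (M : ℝ) ^ (C * (-Real.log ε / ε)) := by
    rw [← Real.rpow_natCast]
    exact Real.rpow_le_rpow_of_exponent_le (by exact_mod_cast hM) hN
  exact e1.trans (by gcongr)
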